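/- Let $h\ge 2$ be an integer, $q=e^{i\pi/h}$, $q^{1/2}=e^{i\pi/(2h)}$ and $[n]=(q^n-q^{-n})/(q-q^{-1})$. For a complex vector space $E$ with an endomorphism $d$ such that $d^h=0$, put $H_{(n)}(E,d)=\operatorname{Ker}(d^n)/\operatorname{Im}(d^{h-n})$, $1\le n\le h-1$. Let $\mathcal F$ be the $h^2$-dimensional $q$-Fock space of the zero modes $a^i_\alpha$ ($i,\alpha\in\{1,2\}$), with basis $(a^1_1)^m(a^1_2)^{m'}|1,0\rangle$, $0\le m,m'\le h-1$, on which $q^p$ has eigenvalue $q^{m+m'+1}$; here $a^2_\alpha|1,0\rangle=0$, $(a^i_\alpha)^h=0$, $a^i_2a^i_1=q\,a^i_1a^i_2$, $[a^1_\alpha,a^2_\alpha]=0$, $a^1_\alpha a^2_\beta-a^2_\alpha a^1_\beta=[p]\,\mathcal E_{\alpha\beta}$ with $\mathcal E_{12}=-q^{1/2}$, $\mathcal E_{21}=q^{-1/2}$, $\mathcal E_{11}=\mathcal E_{22}=0$. A copy of $U_q(\mathfrak{sl}_2)$ acts on $\mathcal F$ with $E|1,0\rangle=F|1,0\rangle=0$,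 $q^{H/2}|1,0\rangle=|1,0\rangle$, $q^{H/2}a^i_1=q^{1/2}a^i_1q^{H/2}$, $q^{H/2}a^i_2=q^{-1/2}a^i_2q^{H/2}$, $[E,a^i_1]=0$, $[E,a^i_2]=a^i_1q^H$, $Fa^i_1-q^{-1}a^i_1F=a^i_2$, $Fa^i_2=q\,a^i_2F$. Let $\bar{\mathcal F}$ be a second copy of this Fock space, with $\bar a^\alpha_i$, $\bar p$ obeying the same relations as $a^i_\alpha$, $p$, and with a copy of $U_q(\mathfrak{sl}_2)$ that fixes its vacuum in the same sense and satisfies $q^{\bar H/2}\bar a^1_i=q^{-1/2}\bar a^1_iq^{\bar H/2}$, $q^{\bar H/2}\bar a^2_i=q^{1/2}\bar a^2_iq^{\bar H/2}$, $q\bar E\bar a^1_i-\bar a^1_i\bar E=-\bar a^2_i$, $q^{-1}\bar E\bar a^2_i=\bar a^2_i\bar E$, $[\bar a^1_i,\bar F]=0$, $[\bar a^2_i,\bar F]=q^{-\bar H}\bar a^1_i$. Let $\mathcal H=\mathcal F\otimes\bar{\mathcal F}$, $A=\sum_\alpha a^2_\alpha\bar a^\alpha_2$, $B=\sum_\alpha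 a^1_\alpha\bar a^\alpha_2$, $B'=-\sum_\alpha a^2_\alpha\bar a^\alpha_1$. Let $\mathcal H_I\subset\mathcal H$ be the subspace of vectors $v$ invariant under both quantum groups, that is $Xv=\varepsilon(X)v$ for all $X$ in the algebra generated by $q^{\pm(H+\bar H)/2}$, $E+q^H\bar E$, $Fq^{-\bar H}+\bar F$ and by $q^{\pm(p-\bar p)}$, $B$, $B'$, where the counit $\varepsilon$ is $1$ on the powers of $q$ and $0$ on the other generators. The operator $A$ commutes with this algebra, so it maps $\mathcal H_I$ to itself. Then: 1. $\dim\mathcal H=h^4$. 2. $\dim H_{(n)}(\mathcal H_I,A)=1$ for all $n\in\{1,\dots,h-1\}$. 3. If $E$ is a finite-dimensional complex vector space with an endomorphism $d$ such that $d^h=0$ and $\dim H_{(n)}(E,d)=1$ for all $n\in\{1,\dots,h-1\}$, then $\dim E\equiv 1$ or $\dim E\equiv-1\pmod h$. 4. There is no endomorphism $Q$ of $\mathcal H$ with $Q^h=0$ such that $H_{(n)}(\mathcal H,Q)\cong H_{(n)}(\mathcal H_I,A)$ as vector spaces for all $n\in\{1,\dots,h-1\}$. -/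

import Mathlib

open scoped TensorProduct

namespace ZeroModes

/-! ## Generalized homology of an `h`-differential -/

/-- `H_(k)(E, d) = Ker (d^k) / Im (d^(h-k))` for an endomorphism `d` of a complex vector space
`E` (meant for `d ^ h = 0` and `1 ≤ k ≤ h - 1`, where `Im (d^(h-k)) ⊆ Ker (d^k)`). -/
abbrev GenHomology (h k : ℕ) {E : Type*} [AddCommGroup E] [Module ℂ E] (d : Module.End ℂ E) :
    Type _ :=
  LinearMap.ker (d ^ k) ⧸
    (LinearMap.range (d ^ (h - k))).comap (LinearMap.ker (d ^ k)).subtype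

/-! ## The deformation parameter -/

noncomputable section

/-- `q^{1/2} = exp (i π / (2h))`. -/
def qh (h : ℕ) : ℂ := Complex.exp (Real.pi * Complex.I / (2 * h))

/-- `q = exp (i π / h)`. -/
def q (h : ℕ) : ℂ := Complex.exp (Real.pi * Complex.I / h)

/-- The `q`-number `[n] = (q^n - q^{-n}) / (q - q^{-1})`. -/
def qn (h : ℕ) (n : ℤ) : ℂ := (q h ^ n - q h ^ (-n)) / (q h - (q h)⁻¹)

theorem qh_ne (h : ℕ) : qh h ≠ 0 := Complex.exp_ne_zero _

theorem q_ne (h : ℕ) : q h ≠ 0 := Complex.exp_ne_zero _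

theorem q_eq (h : ℕ) : q h = qh h ^ (2 : ℤ) := by
  have : (2 : ℤ) = ((2 : ℕ) : ℤ) := rfl
  rw [this, zpow_natCast, q, qh, ← Complex.exp_nat_mul]
  congr 1
  push_cast
  rcases eq_or_ne (h : ℂ) 0 with h0 | h0
  · simp [h0]
  · field_simp

theorem q_pow_h {h : ℕ} (hh : 2 ≤ h) : q h ^ (h : ℤ) = -1 := by
  have h0 : (h : ℂ) ≠ 0 := by exact_mod_cast (by omega : h ≠ 0)
  rw [zpow_natCast, q, ← Complex.exp_nat_mul, mul_div_cancel₀ _ h0, Complex.exp_pi_mul_I]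

theorem q_sub_ne {h : ℕ} (hh : 2 ≤ h) : q h - (q h)⁻¹ ≠ 0 := by
  intro hq
  have hpos : (0 : ℝ) < h := by exact_mod_cast (by omega : 0 < h)
  have h2 : (2 : ℝ) ≤ h := by exact_mod_cast hh
  have him : (q h).im = Real.sin (Real.pi / h) := by
    have : q h = Complex.exp (((Real.pi / h : ℝ) : ℂ) * Complex.I) := by
      rw [q]; congr 1; push_cast; ring
    rw [this, Complex.exp_ofReal_mul_I_im]
  have hs : 0 < Real.sin (Real.pi / h) := by
    apply Real.sin_pos_of_pos_of_lt_pi (by positivity)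
    rw [div_lt_iff₀ hpos]
    nlinarith [Real.pi_pos]
  have hinv : (q h)⁻¹ = Complex.exp (((-(Real.pi / h) : ℝ) : ℂ) * Complex.I) := by
    rw [q, ← Complex.exp_neg]; congr 1; push_cast; ring
  have := congrArg Complex.im hq
  rw [Complex.sub_im, him, hinv, Complex.exp_ofReal_mul_I_im, Real.sin_neg] at this
  simp at this
  linarith

theorem qn_zero (h : ℕ) : qn h 0 = 0 := by simp [qn]

theorem qn_h {h : ℕ} (hh : 2 ≤ h) : qn h h = 0 := by
  rw [qn, zpow_neg, q_pow_h hh]; norm_num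

theorem qn_add {h : ℕ} (m n : ℤ) : qn h (m + n) = q h ^ n * qn h m + q h ^ (-m) * qn h n := by
  simp only [qn, neg_add, zpow_add₀ (q_ne h)]
  ring

theorem qn_one {h : ℕ} (hh : 2 ≤ h) : qn h 1 = 1 := by
  simp only [qn, zpow_one, zpow_neg]
  exact div_self (q_sub_ne hh)

/-! ## The `q`-Fock space of the zero modes -/

/-- The `h²`-dimensional Fock space: coordinates with respect to the basis
`|p, m⟩ = (a^1_1)^m (a^1_2)^{m'} |1, 0⟩`, `0 ≤ m, m' ≤ h - 1`, `p = m + m' + 1`. -/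
abbrev Fock (h : ℕ) : Type := Fin h × Fin h → ℂ

/-- `ket h m m' = (a^1_1)^m (a^1_2)^{m'} |1, 0⟩`, which is zero as soon as `m` or `m'` is
at least `h`. -/
def ket (h m m' : ℕ) : Fock h :=
  if hm : m < h ∧ m' < h then Pi.single (⟨m, hm.1⟩, ⟨m', hm.2⟩) 1 else 0

/-- The linear map with `ket h m m' ↦ g m m'` for `m, m' < h`. -/
def op (h : ℕ) (g : ℕ → ℕ → Fock h) : Module.End ℂ (Fock h) :=
  (Pi.basisFun ℂ (Fin h × Fin h)).constr ℂ (fun x => g x.1 x.2)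

theorem ket_out {h m m' : ℕ} (hm : ¬ (m < h ∧ m' < h)) : ket h m m' = 0 := dif_neg hm

theorem op_ket {h : ℕ} {g : ℕ → ℕ → Fock h}
    (hg : ∀ m m', ¬ (m < h ∧ m' < h) → g m m' = 0) (m m' : ℕ) :
    op h g (ket h m m') = g m m' := by
  by_cases hm : m < h ∧ m' < h
  · have := (Pi.basisFun ℂ (Fin h × Fin h)).constr_basis ℂ
      (fun x => g x.1 x.2) (⟨m, hm.1⟩, ⟨m', hm.2⟩)
    rw [Pi.basisFun_apply] at this
    rw [ket, dif_pos hm]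
    exact this
  · rw [ket_out hm, map_zero, hg m m' hm]

theorem end_ext {h : ℕ} {f g : Module.End ℂ (Fock h)}
    (hfg : ∀ m m', f (ket h m m') = g (ket h m m')) : f = g := by
  refine (Pi.basisFun ℂ (Fin h × Fin h)).ext (fun x => ?_)
  have := hfg x.1 x.2
  rw [ket, dif_pos ⟨x.1.2, x.2.2⟩] at this
  rw [Pi.basisFun_apply]
  exact this

/-- The left zero modes `a^i_α` (`i`, `α` run over `0, 1` here instead of `1, 2`). They are the
operators fixed by the exchange relations, the determinant condition and `a^2_α |1, 0⟩ = 0`;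
see `exchange`, `commute_zeroModes`, `determinant` and the other facts below. -/
def a (h : ℕ) : Fin 2 → Fin 2 → Module.End ℂ (Fock h)
  | 0, 0 => op h fun m m' => ket h (m + 1) m'
  | 0, 1 => op h fun m m' => q h ^ (m : ℤ) • ket h m (m' + 1)
  | 1, 0 => op h fun m m' => (qh h * qn h m') • ket h m (m' - 1)
  | 1, 1 => op h fun m m' => (-((qh h)⁻¹ * q h ^ (-(m' : ℤ)) * qn h m)) • ket h (m - 1) m'

/-- The operator `q^{e p}`. -/
def qP (h : ℕ) (e : ℤ) : Module.End ℂ (Fock h) :=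
  op h fun m m' => q h ^ (e * (m + m' + 1)) • ket h m m'

/-- The operator `[p]`. -/
def brP (h : ℕ) : Module.End ℂ (Fock h) := (q h - (q h)⁻¹)⁻¹ • (qP h 1 - qP h (-1))

/-- The operator `q^{e H / 2}`, for the left `U_q(sl_2)`. -/
def qHhalf (h : ℕ) (e : ℤ) : Module.End ℂ (Fock h) :=
  op h fun m m' => qh h ^ (e * (m - m')) • ket h m m'

/-- The raising generator `E` of the left `U_q(sl_2)`. -/
def opE (h : ℕ) : Module.End ℂ (Fock h) :=
  op h fun m m' => qn h m' • ket h (m + 1) (m' - 1)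

/-- The lowering generator `F` of the left `U_q(sl_2)`. -/
def opF (h : ℕ) : Module.End ℂ (Fock h) :=
  op h fun m m' => qn h m • ket h (m - 1) (m' + 1)

/-- The right Fock space, with the basis `(ā^1_1)^m (ā^2_1)^{m'} |1, 0⟩`. -/
abbrev FockBar (h : ℕ) : Type := Fock h

/-- The right zero modes `ā^α_i`: they satisfy the same relations as the `a^i_α`, so they are
given by the same operators. -/
def abar (h : ℕ) (α i : Fin 2) : Module.End ℂ (FockBar h) := a h i α

/-- The operator `q^{e p̄}`. -/
def qPbar (h : ℕ) (e : ℤ) : Module.End ℂ (FockBar h) := qP h e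

/-- The operator `q^{e H̄ / 2}`, for the right `U_q(sl_2)`. -/
def qHbarHalf (h : ℕ) (e : ℤ) : Module.End ℂ (FockBar h) :=
  op h fun m m' => qh h ^ (e * (m' - m)) • ket h m m'

/-- The raising generator `Ē` of the right `U_q(sl_2)`. -/
def opEbar (h : ℕ) : Module.End ℂ (FockBar h) :=
  op h fun m m' => (-((q h)⁻¹ * qn h m)) • ket h (m - 1) (m' + 1)

/-- The lowering generator `F̄` of the right `U_q(sl_2)`. -/
def opFbar (h : ℕ) : Module.End ℂ (FockBar h) :=
  op h fun m m' => (-(q h * qn h m')) • ket h (m + 1) (m' - 1)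

/-! ### Values on all kets -/

theorem qn_ket_right {h : ℕ} (hh : 2 ≤ h) {m m' : ℕ} (hm : ¬ (m < h ∧ m' < h)) (k : ℕ)
    (hk : m ≤ k) : qn h m' • ket h k (m' - 1) = 0 := by
  by_cases h1 : m' = h
  · rw [h1, qn_h hh, zero_smul]
  · rw [ket_out (by omega), smul_zero]

theorem qn_ket_left {h : ℕ} (hh : 2 ≤ h) {m m' : ℕ} (hm : ¬ (m < h ∧ m' < h)) (k : ℕ)
    (hk : m' ≤ k) : qn h m • ket h (m - 1) k = 0 := by
  by_cases h1 : m = h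
  · rw [h1, qn_h hh, zero_smul]
  · rw [ket_out (by omega), smul_zero]

theorem a00_ket (h m m' : ℕ) : a h 0 0 (ket h m m') = ket h (m + 1) m' :=
  op_ket (g := fun m m' => ket h (m + 1) m') (fun _ _ hm => ket_out (by omega)) m m'

theorem a01_ket (h m m' : ℕ) :
    a h 0 1 (ket h m m') = q h ^ (m : ℤ) • ket h m (m' + 1) :=
  op_ket (g := fun m m' => q h ^ (m : ℤ) • ket h m (m' + 1))
    (fun _ _ hm => by rw [ket_out (by omega), smul_zero]) m m'

theorem a10_ket {h : ℕ} (hh : 2 ≤ h) (m m' : ℕ) :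
    a h 1 0 (ket h m m') = (qh h * qn h m') • ket h m (m' - 1) :=
  op_ket (g := fun m m' => (qh h * qn h m') • ket h m (m' - 1))
    (fun _ _ hm => by rw [mul_smul, qn_ket_right hh hm _ le_rfl, smul_zero]) m m'

theorem a11_ket {h : ℕ} (hh : 2 ≤ h) (m m' : ℕ) :
    a h 1 1 (ket h m m') =
      (-((qh h)⁻¹ * q h ^ (-(m' : ℤ)) * qn h m)) • ket h (m - 1) m' :=
  op_ket (g := fun m m' => (-((qh h)⁻¹ * q h ^ (-(m' : ℤ)) * qn h m)) • ket h (m - 1) m')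
    (fun _ _ hm => by rw [neg_smul, mul_smul, qn_ket_left hh hm _ le_rfl, smul_zero, neg_zero])
    m m'

theorem qP_ket (h : ℕ) (e : ℤ) (m m' : ℕ) :
    qP h e (ket h m m') = q h ^ (e * (m + m' + 1)) • ket h m m' :=
  op_ket (g := fun m m' => q h ^ (e * (m + m' + 1)) • ket h m m')
    (fun _ _ hm => by rw [ket_out hm, smul_zero]) m m'

theorem brP_ket (h m m' : ℕ) : brP h (ket h m m') = qn h (m + m' + 1) • ket h m m' := by
  simp only [brP, LinearMap.smul_apply, LinearMap.sub_apply, qP_ket, qn, ← sub_smul, smul_smul]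
  congr 1
  rw [one_mul, neg_one_mul, div_eq_inv_mul]

theorem qHhalf_ket (h : ℕ) (e : ℤ) (m m' : ℕ) :
    qHhalf h e (ket h m m') = qh h ^ (e * (m - m')) • ket h m m' :=
  op_ket (g := fun m m' => qh h ^ (e * (m - m')) • ket h m m')
    (fun _ _ hm => by rw [ket_out hm, smul_zero]) m m'

theorem qHbarHalf_ket (h : ℕ) (e : ℤ) (m m' : ℕ) :
    qHbarHalf h e (ket h m m') = qh h ^ (e * (m' - m)) • ket h m m' :=
  op_ket (g := fun m m' => qh h ^ (e * (m' - m)) • ket h m m')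
    (fun _ _ hm => by rw [ket_out hm, smul_zero]) m m'

theorem opE_ket {h : ℕ} (hh : 2 ≤ h) (m m' : ℕ) :
    opE h (ket h m m') = qn h m' • ket h (m + 1) (m' - 1) :=
  op_ket (g := fun m m' => qn h m' • ket h (m + 1) (m' - 1))
    (fun _ _ hm => qn_ket_right hh hm _ (by omega)) m m'

theorem opF_ket {h : ℕ} (hh : 2 ≤ h) (m m' : ℕ) :
    opF h (ket h m m') = qn h m • ket h (m - 1) (m' + 1) :=
  op_ket (g := fun m m' => qn h m • ket h (m - 1) (m' + 1))
    (fun _ _ hm => qn_ket_left hh hm _ (by omega)) m m'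

theorem opEbar_ket {h : ℕ} (hh : 2 ≤ h) (m m' : ℕ) :
    opEbar h (ket h m m') = (-((q h)⁻¹ * qn h m)) • ket h (m - 1) (m' + 1) :=
  op_ket (g := fun m m' => (-((q h)⁻¹ * qn h m)) • ket h (m - 1) (m' + 1))
    (fun _ _ hm => by
      rw [neg_smul, mul_smul, qn_ket_left hh hm _ (by omega), smul_zero, neg_zero]) m m'

theorem opFbar_ket {h : ℕ} (hh : 2 ≤ h) (m m' : ℕ) :
    opFbar h (ket h m m') = (-(q h * qn h m')) • ket h (m + 1) (m' - 1) :=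
  op_ket (g := fun m m' => (-(q h * qn h m')) • ket h (m + 1) (m' - 1))
    (fun _ _ hm => by
      rw [neg_smul, mul_smul, qn_ket_right hh hm _ (by omega), smul_zero, neg_zero]) m m'

/-! ### The relations of the zero modes -/

/-- `a^i_2 a^i_1 = q a^i_1 a^i_2`. -/
theorem exchange {h : ℕ} (hh : 2 ≤ h) (i : Fin 2) :
    a h i 1 * a h i 0 = q h • (a h i 0 * a h i 1) := by
  have hq := q_ne h
  have hq' := qh_ne h
  fin_cases i <;> refine end_ext fun m m' => ?_
  · simp [a00_ket, a01_ket, zpow_add₀ hq, smul_smul, mul_comm]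
  · rcases m' with _ | m'
    · simp [a10_ket hh, a11_ket hh, qn_zero]
    · simp only [Fin.mk_one, Fin.isValue, Module.End.mul_apply, LinearMap.smul_apply,
        a10_ket hh, a11_ket hh, map_smul, smul_smul, Nat.add_sub_cancel]
      congr 1
      push_cast
      simp only [neg_add, zpow_add₀ hq, zpow_neg_one]
      field_simp

/-- `[a^1_α, a^2_α] = 0`. -/
theorem commute_zeroModes {h : ℕ} (hh : 2 ≤ h) (α : Fin 2) :
    a h 0 α * a h 1 α = a h 1 α * a h 0 α := by
  have hq := q_ne h
  have hq' := qh_ne h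
  fin_cases α <;> refine end_ext fun m m' => ?_
  · simp [a00_ket, a10_ket hh]
  · rcases m with _ | m
    · simp [a01_ket, a11_ket hh, qn_zero]
    · simp only [Fin.mk_one, Fin.isValue, Module.End.mul_apply,
        a01_ket, a11_ket hh, map_smul, smul_smul, Nat.add_sub_cancel]
      congr 1
      push_cast
      simp only [neg_add, zpow_add₀ hq, zpow_neg_one, zpow_one]
      field_simp

theorem brP_coeff {h : ℕ} (m m' : ℕ) :
    qn h (m + m') = q h ^ (m' : ℤ) * qn h m + (q h ^ (m : ℤ))⁻¹ * qn h m' := by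
  rw [qn_add, zpow_neg]

theorem brP_coeff' {h : ℕ} (m m' : ℕ) :
    qn h (m + m') = q h ^ (m : ℤ) * qn h m' + (q h ^ (m' : ℤ))⁻¹ * qn h m := by
  rw [add_comm, qn_add, zpow_neg]

/-- The determinant condition `ε_{ij} a^i_α a^j_β = [p] 𝓔_{αβ}`, `ε_{12} = 1`, for the four
values of `(α, β)`: the cases `α = β` are `commute_zeroModes`, the others are here. -/
theorem determinant {h : ℕ} (hh : 2 ≤ h) :
    a h 0 0 * a h 1 1 - a h 1 0 * a h 0 1 = (-qh h) • brP h ∧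
    a h 0 1 * a h 1 0 - a h 1 1 * a h 0 0 = (qh h)⁻¹ • brP h := by
  have hq := q_ne h
  have hq' := qh_ne h
  have hq2 : q h = qh h ^ 2 := by rw [q_eq]; rfl
  constructor <;> refine end_ext fun m m' => ?_
  · rcases m with _ | m
    · simp only [Module.End.mul_apply, LinearMap.smul_apply, LinearMap.sub_apply, a00_ket, a01_ket,
        a10_ket hh, a11_ket hh, map_smul, smul_smul, Nat.add_sub_cancel, brP_ket]
      simp [qn_zero]
    · simp only [Module.End.mul_apply, LinearMap.smul_apply, LinearMap.sub_apply, a00_ket, a01_ket,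
        a10_ket hh, a11_ket hh, map_smul, smul_smul, Nat.add_sub_cancel, brP_ket, ← sub_smul]
      congr 1
      have := brP_coeff' (h := h) (m + 1) (m' + 1)
      push_cast at this ⊢
      rw [add_assoc, this]
      simp only [zpow_add₀ hq, zpow_neg, zpow_one]
      field_simp
      rw [hq2]; ring
  · rcases m' with _ | m'
    · simp only [Module.End.mul_apply, LinearMap.smul_apply, LinearMap.sub_apply, a00_ket, a01_ket,
        a10_ket hh, a11_ket hh, map_smul, smul_smul, Nat.add_sub_cancel, brP_ket]
      simp [qn_zero]
    · simp only [Module.End.mul_apply, LinearMap.smul_apply, LinearMap.sub_apply, a00_ket, a01_ket,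
        a10_ket hh, a11_ket hh, map_smul, smul_smul, Nat.add_sub_cancel, brP_ket, ← sub_smul]
      congr 1
      have := brP_coeff' (h := h) (m + 1) (m' + 1)
      push_cast at this ⊢
      rw [show (m : ℤ) + (m' + 1) + 1 = m + 1 + (m' + 1) by ring, this]
      simp only [neg_add, zpow_add₀ hq, zpow_neg, zpow_one]
      field_simp
      rw [hq2]; ring

/-- `q^{ep} a^1_α = a^1_α q^{e(p+1)}` and `q^{ep} a^2_α = a^2_α q^{e(p-1)}`. -/
theorem shift {h : ℕ} (hh : 2 ≤ h) (e : ℤ) (α : Fin 2) :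
    qP h e * a h 0 α = q h ^ e • (a h 0 α * qP h e) ∧
    qP h e * a h 1 α = q h ^ (-e) • (a h 1 α * qP h e) := by
  have hq := q_ne h
  have hq' := qh_ne h
  fin_cases α <;> constructor <;> refine end_ext fun m m' => ?_ <;>
    rcases m with _ | m <;> rcases m' with _ | m' <;>
    simp [qP_ket, a00_ket, a01_ket, a10_ket hh, a11_ket hh, smul_smul, qn_zero, mul_add,
      zpow_add₀ hq] <;> congr 1 <;> field_simp <;> simp [zpow_mul]

theorem qHhalf_add (h : ℕ) (e e' : ℤ) : qHhalf h e * qHhalf h e' = qHhalf h (e + e') := by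
  refine end_ext fun m m' => ?_
  simp [qHhalf_ket, smul_smul, add_mul, zpow_add₀ (qh_ne h), mul_comm]

/-! ### The exchange relations of the zero modes with the two copies of `U_q(sl_2)` -/

/-- `q^H a^i_α = a^i_α q^{H + δ^1_α - δ^2_α}`. -/
theorem qHhalf_a {h : ℕ} (hh : 2 ≤ h) (e : ℤ) (i : Fin 2) :
    qHhalf h e * a h i 0 = qh h ^ e • (a h i 0 * qHhalf h e) ∧
    qHhalf h e * a h i 1 = qh h ^ (-e) • (a h i 1 * qHhalf h e) := by
  have hq := qh_ne h
  fin_cases i <;> constructor <;> refine end_ext fun m m' => ?_ <;>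
    rcases m with _ | m <;> rcases m' with _ | m' <;>
    simp [qHhalf_ket, a00_ket, a01_ket, a10_ket hh, a11_ket hh, smul_smul, qn_zero, mul_add,
      mul_sub, zpow_add₀ hq, zpow_sub₀ hq] <;> congr 1 <;> field_simp

/-- `q^{H̄} ā^α_i = ā^α_i q^{H̄ - δ^1_α + δ^2_α}`. -/
theorem qHbarHalf_abar {h : ℕ} (hh : 2 ≤ h) (e : ℤ) (i : Fin 2) :
    qHbarHalf h e * abar h 0 i = qh h ^ (-e) • (abar h 0 i * qHbarHalf h e) ∧
    qHbarHalf h e * abar h 1 i = qh h ^ e • (abar h 1 i * qHbarHalf h e) := by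
  have hq := qh_ne h
  fin_cases i <;> constructor <;> refine end_ext fun m m' => ?_ <;>
    rcases m with _ | m <;> rcases m' with _ | m' <;>
    simp [abar, qHbarHalf_ket, a00_ket, a01_ket, a10_ket hh, a11_ket hh, smul_smul, qn_zero,
      mul_add, mul_sub, zpow_add₀ hq, zpow_sub₀ hq] <;> congr 1 <;> field_simp

theorem q_sq_ne {h : ℕ} (hh : 2 ≤ h) : q h ^ 2 - 1 ≠ 0 := by
  intro h1
  apply q_sub_ne hh
  have := q_ne h
  field_simp
  simpa using h1

theorem qh_zpow_two (h : ℕ) (e : ℤ) : qh h ^ (2 * e) = q h ^ e := by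
  rw [q_eq, zpow_mul]

/-- `[E, a^i_α] = δ^2_α a^i_1 q^H`. -/
theorem opE_a {h : ℕ} (hh : 2 ≤ h) (i : Fin 2) :
    opE h * a h i 0 = a h i 0 * opE h ∧
    opE h * a h i 1 = a h i 1 * opE h + a h i 0 * qHhalf h 2 := by
  have hq := q_ne h
  have hq' := qh_ne h
  have hD := q_sq_ne hh
  have hq2 : q h = qh h ^ 2 := by rw [q_eq]; rfl
  fin_cases i <;> constructor <;> refine end_ext fun m m' => ?_ <;>
    rcases m with _ | m <;> rcases m' with _ | m' <;>
    simp [opE_ket hh, qHhalf_ket, a00_ket, a01_ket, a10_ket hh, a11_ket hh, smul_smul, qn_zero,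
      qh_zpow_two, qn_one hh] <;> try match_scalars
  all_goals (simp [qn, zpow_add₀ hq, zpow_sub₀ hq]; field_simp)

  all_goals (simp only [hq2]; ring)

/-- `F a^i_α - q^{2α-3} a^i_α F = δ^1_α a^i_2`. -/
theorem opF_a {h : ℕ} (hh : 2 ≤ h) (i : Fin 2) :
    opF h * a h i 0 = (q h)⁻¹ • (a h i 0 * opF h) + a h i 1 ∧
    opF h * a h i 1 = q h • (a h i 1 * opF h) := by
  have hq := q_ne h
  have hq' := qh_ne h
  have hD := q_sq_ne hh
  have hq2 : q h = qh h ^ 2 := by rw [q_eq]; rfl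
  fin_cases i <;> constructor <;> refine end_ext fun m m' => ?_ <;>
    rcases m with _ | m <;> rcases m' with _ | m' <;>
    simp [opF_ket hh, a00_ket, a01_ket, a10_ket hh, a11_ket hh, smul_smul, qn_zero, qn_one hh] <;> try match_scalars
  all_goals (simp [qn, zpow_add₀ hq]; field_simp)
  all_goals (simp only [hq2]; try ring)

/-- `q^{3-2α} Ē ā^α_i - ā^α_i Ē = - δ^1_α ā^2_i`. -/
theorem opEbar_abar {h : ℕ} (hh : 2 ≤ h) (i : Fin 2) :
    q h • (opEbar h * abar h 0 i) = abar h 0 i * opEbar h - abar h 1 i ∧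
    (q h)⁻¹ • (opEbar h * abar h 1 i) = abar h 1 i * opEbar h := by
  have hq := q_ne h
  have hq' := qh_ne h
  have hD := q_sq_ne hh
  have hq2 : q h = qh h ^ 2 := by rw [q_eq]; rfl
  fin_cases i <;> constructor <;> refine end_ext fun m m' => ?_ <;>
    rcases m with _ | m <;> rcases m' with _ | m' <;>
    simp [abar, opEbar_ket hh, a00_ket, a01_ket, a10_ket hh, a11_ket hh, smul_smul,
      qn_zero, qn_one hh] <;> try match_scalars
  all_goals (simp [qn, zpow_add₀ hq]; field_simp)
  all_goals (simp only [hq2]; try ring)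

/-- `[ā^α_i, F̄] = δ^2_α q^{-H̄} ā^1_i`. -/
theorem opFbar_abar {h : ℕ} (hh : 2 ≤ h) (i : Fin 2) :
    abar h 0 i * opFbar h = opFbar h * abar h 0 i ∧
    abar h 1 i * opFbar h = opFbar h * abar h 1 i + qHbarHalf h (-2) * abar h 0 i := by
  have hq := q_ne h
  have hq' := qh_ne h
  have hD := q_sq_ne hh
  have hq2 : q h = qh h ^ 2 := by rw [q_eq]; rfl
  have hz : ∀ e : ℤ, qh h ^ (-(2 * e)) = q h ^ (-e) := fun e => by rw [← mul_neg, qh_zpow_two]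
  fin_cases i <;> constructor <;> refine end_ext fun m m' => ?_ <;>
    rcases m with _ | m <;> rcases m' with _ | m' <;>
    simp [abar, opFbar_ket hh, qHbarHalf_ket, a00_ket, a01_ket, a10_ket hh, a11_ket hh, smul_smul,
      qn_zero, hz, qn_one hh] <;> try match_scalars
  all_goals (simp [qn, zpow_add₀ hq, zpow_sub₀ hq] <;> field_simp)
  all_goals (simp only [hq2]; ring)

/-! ### The vacuum and the factor algebra -/

/-- `a^2_α |1, 0⟩ = 0`, `q^p |1, 0⟩ = q |1, 0⟩`, and the vacuum is invariant under `E`, `F`,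
`q^{± H/2}`; likewise on the right. -/
theorem vacuum {h : ℕ} (hh : 2 ≤ h) (e : ℤ) :
    a h 1 0 (ket h 0 0) = 0 ∧ a h 1 1 (ket h 0 0) = 0 ∧
    qP h e (ket h 0 0) = q h ^ e • ket h 0 0 ∧
    opE h (ket h 0 0) = 0 ∧ opF h (ket h 0 0) = 0 ∧ qHhalf h e (ket h 0 0) = ket h 0 0 ∧
    opEbar h (ket h 0 0) = 0 ∧ opFbar h (ket h 0 0) = 0 ∧
    qHbarHalf h e (ket h 0 0) = ket h 0 0 := by
  simp [a10_ket hh, a11_ket hh, qP_ket, opE_ket hh, opF_ket hh, qHhalf_ket, opEbar_ket hh,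
    opFbar_ket hh, qHbarHalf_ket, qn_zero]

theorem ket_eq (h m m' : ℕ) : ket h m m' = (a h 0 0 ^ m * a h 0 1 ^ m') (ket h 0 0) := by
  have h1 : ∀ m', (a h 0 1 ^ m') (ket h 0 0) = ket h 0 m' := by
    intro m'
    induction m' with
    | zero => simp
    | succ k ih => rw [pow_succ', Module.End.mul_apply, ih, a01_ket]; simp
  induction m with
  | zero => simp [h1]
  | succ k ih => rw [pow_succ', mul_assoc, Module.End.mul_apply, ← ih, a00_ket]

/-- `(a^i_α)^h = 0`. -/
theorem a_pow_h {h : ℕ} (hh : 2 ≤ h) (i α : Fin 2) : a h i α ^ h = 0 := by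
  have up0 : ∀ k m m', (a h 0 0 ^ k) (ket h m m') = ket h (m + k) m' := by
    intro k
    induction k with
    | zero => simp
    | succ k ih =>
      intro m m'; rw [pow_succ, Module.End.mul_apply, a00_ket, ih]; congr 1; omega
  have up1 : ∀ k m m', ∃ c : ℂ, (a h 0 1 ^ k) (ket h m m') = c • ket h m (m' + k) := by
    intro k
    induction k with
    | zero => exact fun m m' => ⟨1, by simp⟩
    | succ k ih =>
      intro m m'
      obtain ⟨c, hc⟩ := ih m (m' + 1)
      refine ⟨q h ^ (m : ℤ) * c, ?_⟩
      rw [pow_succ, Module.End.mul_apply, a01_ket, map_smul, hc, smul_smul]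
      congr 2; omega
  have dn0 : ∀ k m m', m' < k → (a h 1 0 ^ k) (ket h m m') = 0 := by
    intro k
    induction k with
    | zero => omega
    | succ k ih =>
      intro m m' hm
      rw [pow_succ, Module.End.mul_apply, a10_ket hh, map_smul]
      rcases m' with _ | m'
      · simp [qn_zero]
      · rw [ih _ _ (by omega), smul_zero]
  have dn1 : ∀ k m m', m < k → (a h 1 1 ^ k) (ket h m m') = 0 := by
    intro k
    induction k with
    | zero => omega
    | succ k ih =>
      intro m m' hm
      rw [pow_succ, Module.End.mul_apply, a11_ket hh, map_smul]
      rcases m with _ | m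
      · simp [qn_zero]
      · rw [ih _ _ (by omega), smul_zero]
  refine end_ext fun m m' => ?_
  rw [LinearMap.zero_apply]
  by_cases hm : m < h ∧ m' < h
  · fin_cases i <;> fin_cases α
    · exact (up0 h m m').trans (ket_out (by omega))
    · obtain ⟨c, hc⟩ := up1 h m m'
      exact hc.trans (by rw [ket_out (by omega), smul_zero])
    · exact dn0 h m m' hm.2
    · exact dn1 h m m' hm.1
  · rw [ket_out hm, map_zero]

/-- `[h p] = 0`. -/
theorem br_h_p {h : ℕ} (hh : 2 ≤ h) :
    (q h - (q h)⁻¹)⁻¹ • (qP h h - qP h (-h)) = 0 := by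
  refine end_ext fun m m' => ?_
  have : q h ^ ((h : ℤ) * (m + m' + 1)) = q h ^ (-(h : ℤ) * (m + m' + 1)) := by
    rw [zpow_mul, zpow_mul, zpow_neg, q_pow_h hh]; norm_num
  rw [LinearMap.smul_apply, LinearMap.sub_apply, qP_ket, qP_ket, this, sub_self, smul_zero,
    LinearMap.zero_apply]

/-! ## The state space and the operators acting on it -/

/-- The state space `𝓗 = 𝓕 ⊗ 𝓕̄`. -/
abbrev StateSpace (h : ℕ) : Type := Fock h ⊗[ℂ] FockBar h

/-- `a^i_α ā^α_j`, summed over `α`. -/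
def contr (h : ℕ) (i j : Fin 2) : Module.End ℂ (StateSpace h) :=
  ∑ α, TensorProduct.map (a h i α) (abar h α j)

/-- `A = a^2_α ā^α_2`. -/
def A (h : ℕ) : Module.End ℂ (StateSpace h) := contr h 1 1

/-- Generators of the pair of quantum universal enveloping algebras: `K^{± 1/2}`, `E`, `F` for
`U_q(sl_2)_Δ`, and `q^{±(p - p̄)}`, `B`, `B'` for `U_q(sl_2)_B`. -/
inductive Gen
  | K | Kinv | E | F | L | Linv | B | B'

/-- The action of the generators on `𝓗`: `Δ(K^{±1/2}) = q^{±(H + H̄)/2}`, `Δ(E) = E + q^H Ē`,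
`Δ(F) = F q^{-H̄} + F̄`, `q^{±(p - p̄)}`, `B = a^1_α ā^α_2`, `B' = - a^2_α ā^α_1`. -/
def genAct (h : ℕ) : Gen → Module.End ℂ (StateSpace h)
  | .K => TensorProduct.map (qHhalf h 1) (qHbarHalf h 1)
  | .Kinv => TensorProduct.map (qHhalf h (-1)) (qHbarHalf h (-1))
  | .E => TensorProduct.map (opE h) 1 + TensorProduct.map (qHhalf h 2) (opEbar h)
  | .F => TensorProduct.map (opF h) (qHbarHalf h (-2)) + TensorProduct.map 1 (opFbar h)
  | .L => TensorProduct.map (qP h 1) (qPbar h (-1))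
  | .Linv => TensorProduct.map (qP h (-1)) (qPbar h 1)
  | .B => contr h 0 1
  | .B' => - contr h 1 0

/-- The counit on the generators. -/
def genCounit : Gen → ℂ
  | .K | .Kinv | .L | .Linv => 1
  | .E | .F | .B | .B' => 0

/-- The action on `𝓗` of polynomials in the generators. The quantum group is a quotient of this
free algebra, and its action and counit are induced by `act` and `counit`. -/
def act (h : ℕ) : FreeAlgebra ℂ Gen →ₐ[ℂ] Module.End ℂ (StateSpace h) :=
  FreeAlgebra.lift ℂ (genAct h)

/-- The counit. -/
def counit : FreeAlgebra ℂ Gen →ₐ[ℂ] ℂ := FreeAlgebra.lift ℂ genCounit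

/-- The subspace `𝓗_I` of quantum group invariant vectors, `X v = ε(X) v` for all `X`. -/
def invariants (h : ℕ) : Submodule ℂ (StateSpace h) where
  carrier := {v | ∀ X, act h X v = counit X • v}
  zero_mem' X := by simp
  add_mem' hv hw X := by rw [map_add, hv X, hw X, smul_add]
  smul_mem' c v hv X := by rw [map_smul, hv X, smul_comm]

theorem A_comm_gen {h : ℕ} (hh : 2 ≤ h) (x : Gen) : A h * genAct h x = genAct h x * A h := by
  have hq := q_ne h
  have hq' := qh_ne h
  have hq2 : q h = qh h ^ 2 := by rw [q_eq]; rfl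
  have K1 := fun e => (qHhalf_a hh e 1).1
  have K2 := fun e => (qHhalf_a hh e 1).2
  have k1 := fun e => (qHbarHalf_abar hh e 1).1
  have k2 := fun e => (qHbarHalf_abar hh e 1).2
  have P1 := fun e => (shift hh e 0).2
  have P2 := fun e => (shift hh e 1).2
  have E1 := (opE_a hh 1).1
  have E2 := (opE_a hh 1).2
  have F1 := (opF_a hh 1).1
  have F2 := (opF_a hh 1).2
  have e1 : opEbar h * abar h 0 1 =
      (q h)⁻¹ • (abar h 0 1 * opEbar h) + (-(q h)⁻¹) • abar h 1 1 := by
    have h1 : opEbar h * abar h 0 1 = (q h)⁻¹ • (q h • (opEbar h * abar h 0 1)) := by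
      rw [smul_smul, inv_mul_cancel₀ hq, one_smul]
    rw [h1, (opEbar_abar hh 1).1]
    module
  have e2 : opEbar h * abar h 1 1 = q h • (abar h 1 1 * opEbar h) := by
    rw [← (opEbar_abar hh 1).2, smul_smul, mul_inv_cancel₀ hq, one_smul]
  have f1 := (opFbar_abar hh 1).1.symm
  have f2 : opFbar h * abar h 1 1 =
      abar h 1 1 * opFbar h + (-1 : ℂ) • (qHbarHalf h (-2) * abar h 0 1) := by
    rw [(opFbar_abar hh 1).2]; module
  have x1 := exchange hh 1
  have X1 : abar h 1 1 * abar h 0 1 = q h • (abar h 0 1 * abar h 1 1) := exchange hh 1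
  have x2 : a h 1 1 * a h 0 0 = a h 0 1 * a h 1 0 + (-(qh h)⁻¹) • brP h := by
    have h1 := (determinant hh).2
    have h2 : a h 1 1 * a h 0 0 = a h 0 1 * a h 1 0 - (qh h)⁻¹ • brP h := by rw [← h1]; abel
    rw [h2]; module
  have x3 : a h 1 0 * a h 0 1 = a h 0 0 * a h 1 1 + qh h • brP h := by
    have h1 := (determinant hh).1
    have h2 : a h 1 0 * a h 0 1 = a h 0 0 * a h 1 1 - (-qh h) • brP h := by rw [← h1]; abel
    rw [h2]; module
  have y2 : abar h 1 1 * abar h 0 0 = abar h 1 0 * abar h 0 1 + (-(qh h)⁻¹) • brP h := x2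
  have y3 : abar h 0 1 * abar h 1 0 = abar h 0 0 * abar h 1 1 + qh h • brP h := x3
  have c1 := (commute_zeroModes hh 0).symm
  have c2 := (commute_zeroModes hh 1).symm
  have d1 : abar h 0 1 * abar h 0 0 = abar h 0 0 * abar h 0 1 := c1
  have d2 : abar h 1 1 * abar h 1 0 = abar h 1 0 * abar h 1 1 := c2
  have hneg : -contr h 1 0 = (-1 : ℂ) • contr h 1 0 := by module
  cases x <;> simp only [A, genAct, hneg, mul_smul_comm, smul_mul_assoc] <;>
    simp only [contr, Fin.sum_univ_two, mul_add, add_mul,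
    ← TensorProduct.map_mul, one_mul, mul_one]
  case K | Kinv =>
    simp only [K1, K2, k1, k2, TensorProduct.map_smul_left, TensorProduct.map_smul_right,
      smul_smul, ← zpow_add₀ hq']
    simp
  case L | Linv =>
    simp only [P1, P2, abar, qPbar, TensorProduct.map_smul_left, TensorProduct.map_smul_right,
      smul_smul, ← zpow_add₀ hq]
    simp
  all_goals
    simp only [K1, K2, k1, k2, E1, E2, F1, F2, e1, e2, f1, f2, x1, X1, x2, x3, y2, y3, c1, c2, d1,
      d2, TensorProduct.map_smul_left, TensorProduct.map_smul_right,
      TensorProduct.map_add_left, TensorProduct.map_add_right, smul_add]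
    match_scalars <;> try field_simp
  all_goals simp [hq2]

/-- `A` leaves the space of invariant vectors stable. -/
theorem A_mapsTo {h : ℕ} (hh : 2 ≤ h) : ∀ v ∈ invariants h, A h v ∈ invariants h := by
  intro v hv X
  have hX : A h * act h X = act h X * A h := by
    induction X using FreeAlgebra.induction with
    | grade0 r => simp [Algebra.commutes]
    | grade1 x => simpa [act] using A_comm_gen hh x
    | mul x y hx hy => rw [map_mul, ← mul_assoc, hx, mul_assoc, hy, mul_assoc]
    | add x y hx hy => rw [map_add, mul_add, add_mul, hx, hy]
  rw [← Module.End.mul_apply, ← hX, Module.End.mul_apply, hv X, map_smul]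

/-- The restriction of `A` to `𝓗_I`. -/
def AI (h : ℕ) (hh : 2 ≤ h) : Module.End ℂ (invariants h) := (A h).restrict (A_mapsTo hh)

end

end ZeroModes

open ZeroModes

/-!
The dimension of `𝓗` is a count. The other three claims rest on two computations.

*Linear algebra.* For `d ^ h = 0` one has `dim H_(n) = dim E - rank d^n - rank d^(h-n)`
(`finrank_genHomology`), and `n ↦ rank d^n` is a convex sequence (`finrank_range_pow_convex`), so
that no Jordan form is needed. If all `H_(n)` are one-dimensional, the drops of this sequence are
symmetric up to a single unit, and convexity makes them all equal but for one end
(`modEq_of_convex_of_symm`); hence `dim E ≡ ± 1` modulo `h`. This excludes an `h`-differential on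
`𝓗` with one-dimensional homologies, because `h` divides `h ^ 4`.

*The invariant vectors.* Invariance under `q^{(H + H̄)/2}` and `q^{p - p̄}` confines a vector to the
span of the `|m, m'⟩ ⊗ |m, m'⟩` (`coord_eq_zero_of_invariant`), and invariance under `E + q^H Ē`
then fixes the ratios of the coordinates with a given `m + m' = N`
(`coord_div_invCoeff_step`). The resulting vectors `invVec h N`, `0 ≤ N ≤ 2 h - 2`, are invariant
under all generators (`genAct_invVec`), so they form a basis of `𝓗_I` (`invBasis`). On it `A` is a
weighted shift, `A v_N = [N + 1] v_{N - 1}` (`A_invVec_succ`), whose only vanishing weight for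
`1 ≤ N ≤ 2 h - 2` is the one at `N = h - 1`. So `A ^ h = 0` and `A` has rank `2 h - 3` on the
`(2 h - 1)`-dimensional space `𝓗_I`. These two facts determine all the ranks by convexity
(`eq_of_convex_of_drop_le_two`), and with them the homologies
(`finrank_genHomology_eq_one`).
-/

namespace ZeroModes

/-! ### Ranks of the powers of an `h`-differential -/

section Ranks

variable {E : Type*} [AddCommGroup E] [Module ℂ E]

theorem finrank_range_pow_zero (d : Module.End ℂ E) :
    Module.finrank ℂ (LinearMap.range (d ^ 0)) = Module.finrank ℂ E := by
  rw [pow_zero, Module.End.one_eq_id, LinearMap.range_id, finrank_top]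

theorem finrank_range_pow_eq_zero {h : ℕ} {d : Module.End ℂ E} (hd : d ^ h = 0) :
    Module.finrank ℂ (LinearMap.range (d ^ h)) = 0 := by
  rw [hd, LinearMap.range_zero, finrank_bot]

variable [FiniteDimensional ℂ E]

/-- `dim H_(n) = dim E - rank d^n - rank d^(h-n)`. -/
theorem finrank_genHomology {h n : ℕ} (hn : n ≤ h) {d : Module.End ℂ E} (hd : d ^ h = 0) :
    Module.finrank ℂ (GenHomology h n d) + Module.finrank ℂ (LinearMap.range (d ^ n)) +
      Module.finrank ℂ (LinearMap.range (d ^ (h - n))) = Module.finrank ℂ E := by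
  have hle : LinearMap.range (d ^ (h - n)) ≤ LinearMap.ker (d ^ n) := by
    rintro _ ⟨x, rfl⟩
    rw [LinearMap.mem_ker, ← Module.End.mul_apply, ← pow_add, Nat.add_sub_cancel' hn, hd,
      LinearMap.zero_apply]
  have h1 := Submodule.finrank_quotient_add_finrank
    ((LinearMap.range (d ^ (h - n))).comap (LinearMap.ker (d ^ n)).subtype)
  have h2 := (Submodule.comapSubtypeEquivOfLe hle).finrank_eq
  have h3 := LinearMap.finrank_range_add_finrank_ker (d ^ n)
  rw [h2] at h1
  unfold GenHomology
  omega

/-- The drops of `n ↦ rank d^n` are non-increasing, because `rank d^n - rank d^(n+1)` is the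
dimension of `ker d ∩ range d^n`. -/
theorem finrank_range_pow_convex (d : Module.End ℂ E) (n : ℕ) :
    2 * Module.finrank ℂ (LinearMap.range (d ^ (n + 1))) ≤
      Module.finrank ℂ (LinearMap.range (d ^ n)) +
        Module.finrank ℂ (LinearMap.range (d ^ (n + 2))) := by
  have drop : ∀ k, Module.finrank ℂ (LinearMap.range (d ^ (k + 1))) +
      Module.finrank ℂ (LinearMap.ker d ⊓ LinearMap.range (d ^ k) : Submodule ℂ E) =
        Module.finrank ℂ (LinearMap.range (d ^ k)) := by
    intro k
    have h1 := LinearMap.finrank_range_add_finrank_ker (d.domRestrict (LinearMap.range (d ^ k)))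
    have h2 : LinearMap.range (d.domRestrict (LinearMap.range (d ^ k))) =
        LinearMap.range (d ^ (k + 1)) := by
      rw [LinearMap.range_domRestrict, pow_succ', Module.End.mul_eq_comp, LinearMap.range_comp]
    have h3 : LinearMap.ker (d.domRestrict (LinearMap.range (d ^ k))) =
        (LinearMap.ker d).comap (LinearMap.range (d ^ k)).subtype := LinearMap.ker_comp _ _
    have h4 := (Submodule.comap_equiv_self_of_inj_of_le
      (f := (LinearMap.range (d ^ k)).subtype) (p := LinearMap.ker d ⊓ LinearMap.range (d ^ k))
      (Submodule.injective_subtype _) (by simp)).finrank_eq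
    rw [Submodule.comap_inf, Submodule.comap_subtype_self, inf_top_eq] at h4
    rw [h2, h3, h4] at h1
    exact h1
  have hle : (LinearMap.ker d ⊓ LinearMap.range (d ^ (n + 1)) : Submodule ℂ E) ≤
      LinearMap.ker d ⊓ LinearMap.range (d ^ n) := by
    refine inf_le_inf_left _ ?_
    rw [pow_succ, Module.End.mul_eq_comp]
    exact LinearMap.range_comp_le_range _ _
  have := Submodule.finrank_mono hle
  have := drop n
  have : _ = Module.finrank ℂ (LinearMap.range (d ^ (n + 1))) := drop (n + 1)
  rw [show n + 1 + 1 = n + 2 from rfl] at this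
  omega

end Ranks

/-! ### Convex integer sequences -/

theorem antitone_drop {r : ℕ → ℤ} (hr : ∀ n, 2 * r (n + 1) ≤ r n + r (n + 2)) :
    Antitone fun n => r n - r (n + 1) :=
  antitone_nat_of_succ_le fun n => by have := hr n; rw [show n + 1 + 1 = n + 2 from rfl]; linarith

theorem sub_le_mul_drop {r : ℕ → ℤ} (hr : ∀ n, 2 * r (n + 1) ≤ r n + r (n + 2)) (i k : ℕ) :
    r i - r (i + k) ≤ k * (r i - r (i + 1)) := by
  induction k with
  | zero => simp
  | succ k ih =>
    have : r (i + k) - r (i + k + 1) ≤ r i - r (i + 1) :=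
      antitone_drop hr (Nat.le_add_right i k)
    push_cast
    rw [← add_assoc]
    linarith

/-- A convex sequence with `r n + r (h - n) = r 0 - 1` drops by `s` at each step except that
either its first drop is `s + 1` or its last drop is `s - 1`. -/
theorem modEq_of_convex_of_symm {h : ℕ} (hh : 2 ≤ h) {r : ℕ → ℤ}
    (hr : ∀ n, 2 * r (n + 1) ≤ r n + r (n + 2)) (hh0 : r h = 0)
    (hs : ∀ n, 1 ≤ n → n ≤ h - 1 → r n + r (h - n) = r 0 - 1) :
    r 0 ≡ 1 [ZMOD h] ∨ r 0 ≡ -1 [ZMOD h] := by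
  obtain ⟨k, rfl⟩ : ∃ k, h = k + 2 := ⟨h - 2, by omega⟩
  have anti := antitone_drop hr
  have h1 := hs 1 le_rfl (by omega)
  rw [show k + 2 - 1 = k + 1 by omega] at h1
  rcases Nat.eq_zero_or_pos k with rfl | hk
  · left
    rw [Int.modEq_iff_dvd]
    exact ⟨-r 1, by push_cast; simp only [zero_add] at h1; linarith⟩
  have h2 := hs 2 (by omega) (by omega)
  rw [show k + 2 - 2 = k by omega] at h2
  -- the drops at `1` and at `k` agree, so all the drops in between do
  have const : ∀ i, 1 ≤ i → i ≤ k → r i - r (i + 1) = r 1 - r 2 := by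
    intro i hi hik
    have ha : r i - r (i + 1) ≤ r 1 - r (1 + 1) := anti hi
    have hb : r k - r (k + 1) ≤ r i - r (i + 1) := anti hik
    norm_num at ha
    linarith
  have lin : ∀ j, j ≤ k → r (1 + j) = r 1 - j * (r 1 - r 2) := by
    intro j
    induction j with
    | zero => simp
    | succ j ih =>
      intro hj
      have h3 := ih (by omega)
      have h4 := const (1 + j) (by omega) (by omega)
      push_cast
      rw [← add_assoc]
      linarith
  have hk1 := lin k le_rfl
  rw [add_comm] at hk1
  have hfirst : r 1 - r (1 + 1) ≤ r 0 - r (0 + 1) := anti (Nat.zero_le 1)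
  have hlast : r (k + 1) - r (k + 1 + 1) ≤ r 1 - r (1 + 1) := anti (by omega)
  norm_num at hfirst
  rw [show k + 1 + 1 = k + 2 from rfl, hh0, show 1 + 1 = 2 from rfl] at hlast
  have hcases : r 1 - r 2 = r 0 - r 1 ∨ r 1 - r 2 = r 0 - r 1 - 1 := by omega
  rw [Int.modEq_iff_dvd, Int.modEq_iff_dvd]
  rcases hcases with hc | hc
  · right
    refine ⟨-(r 1 - r 2), ?_⟩
    push_cast
    linarith
  · left
    refine ⟨-(r 1 - r 2), ?_⟩
    push_cast
    linarith

/-- A convex sequence from `2 h - 1` to `r h = 0` whose first drop is at most `2` has all its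
drops equal to `2`, except the last one. -/
theorem eq_of_convex_of_drop_le_two {h : ℕ} {r : ℕ → ℤ}
    (hr : ∀ n, 2 * r (n + 1) ≤ r n + r (n + 2)) (h0 : r 0 = 2 * h - 1)
    (h1 : 2 * h - 3 ≤ r 1) (hh0 : r h = 0) (n : ℕ) (hn : n < h) : r n = 2 * h - 1 - 2 * n := by
  induction n with
  | zero => simpa using h0
  | succ n ih =>
    have ih := ih (by omega)
    have h2 : r n - r (n + 1) ≤ r 0 - r (0 + 1) := antitone_drop hr (Nat.zero_le n)
    norm_num at h2
    by_contra hne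
    push_cast at hne
    -- a drop of at most `1` at `n` would leave `r h` positive
    have h3 : r n - r (n + 1) ≤ 1 := by omega
    obtain ⟨k, rfl⟩ : ∃ k, h = n + k := ⟨h - n, by omega⟩
    have h4 := sub_le_mul_drop hr n k
    rw [hh0, ih] at h4
    have h5 : (k : ℤ) * (r n - r (n + 1)) ≤ k * 1 := by gcongr
    rw [ih] at h5
    push_cast at *
    omega

/-! ### One-dimensional generalized homologies -/

section OneDimensional

variable {E : Type*} [AddCommGroup E] [Module ℂ E] [FiniteDimensional ℂ E]

theorem finrank_modEq_of_finrank_genHomology {h : ℕ} (hh : 2 ≤ h) {d : Module.End ℂ E}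
    (hd : d ^ h = 0)
    (hE : ∀ n ∈ Finset.Icc 1 (h - 1), Module.finrank ℂ (GenHomology h n d) = 1) :
    (Module.finrank ℂ E : ℤ) ≡ 1 [ZMOD h] ∨ (Module.finrank ℂ E : ℤ) ≡ -1 [ZMOD h] := by
  have h0 := finrank_range_pow_zero d
  rw [← h0]
  refine modEq_of_convex_of_symm hh
    (r := fun k => (Module.finrank ℂ (LinearMap.range (d ^ k)) : ℤ))
    (fun k => by exact_mod_cast finrank_range_pow_convex d k) (by exact_mod_cast finrank_range_pow_eq_zero hd)
    fun n hn1 hn2 => ?_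
  have h1 := finrank_genHomology (n := n) (by omega) hd
  rw [hE n (Finset.mem_Icc.2 ⟨hn1, hn2⟩)] at h1
  rw [h0]
  omega

/-- An `h`-differential of rank at least `2 h - 3` on a space of dimension `2 h - 1` has
one-dimensional generalized homologies: it has two Jordan blocks, of sizes `h` and `h - 1`. -/
theorem finrank_genHomology_eq_one {h : ℕ} {d : Module.End ℂ E} (hd : d ^ h = 0)
    (hE : Module.finrank ℂ E = 2 * h - 1)
    (hr : 2 * h - 3 ≤ Module.finrank ℂ (LinearMap.range d)) {n : ℕ}
    (hn : n ∈ Finset.Icc 1 (h - 1)) : Module.finrank ℂ (GenHomology h n d) = 1 := by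
  obtain ⟨hn1, hn2⟩ := Finset.mem_Icc.1 hn
  have h0 := finrank_range_pow_zero d
  have key := eq_of_convex_of_drop_le_two (h := h)
    (r := fun k => (Module.finrank ℂ (LinearMap.range (d ^ k)) : ℤ))
    (fun k => by exact_mod_cast finrank_range_pow_convex d k) (by rw [h0]; omega)
    (by rw [pow_one]; omega) (by exact_mod_cast finrank_range_pow_eq_zero hd)
  have ha := key n (by omega)
  have hb := key (h - n) (by omega)
  have hc := finrank_genHomology (n := n) (by omega) hd
  omega

end OneDimensional

/-! ### The vectors spanning the invariants -/

/-- `[n]` vanishes only at multiples of `h`, since `q^2` is a primitive `h`-th root of unity. -/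
theorem dvd_of_qn_eq_zero {h : ℕ} (hh : 2 ≤ h) {n : ℤ} (hn : qn h n = 0) : (h : ℤ) ∣ n := by
  have hq := q_ne h
  have h1 : q h ^ n - q h ^ (-n) = 0 := (div_eq_zero_iff.1 hn).resolve_right (q_sub_ne hh)
  have hprim : IsPrimitiveRoot (q h ^ 2) h := by
    have : q h ^ 2 = Complex.exp (2 * Real.pi * Complex.I / h) := by
      rw [q, ← Complex.exp_nat_mul]; congr 1; push_cast; ring
    rw [this]
    exact Complex.isPrimitiveRoot_exp h (by omega)
  rw [← hprim.zpow_eq_one_iff_dvd, ← zpow_natCast, ← zpow_mul, mul_comm, zpow_mul]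
  have h2 : q h ^ n = (q h ^ n)⁻¹ := by rw [← zpow_neg]; exact sub_eq_zero.1 h1
  have h3 : q h ^ n ≠ 0 := zpow_ne_zero _ hq
  have h4 := mul_inv_cancel₀ h3
  rw [← h2] at h4
  rw [show ((2 : ℕ) : ℤ) = 1 + 1 by norm_num, zpow_add₀ h3, zpow_one, h4]

theorem qn_ne_zero_of_lt {h : ℕ} (hh : 2 ≤ h) {m : ℕ} (hm : m + 1 < h) : qn h (m + 1) ≠ 0 := by
  intro h1
  have := Int.le_of_dvd (by omega) (dvd_of_qn_eq_zero hh h1)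
  omega

noncomputable section

/-- The `q`-factorial `[n]! = [1] [2] ⋯ [n]`. -/
def qFact (h n : ℕ) : ℂ := ∏ i ∈ Finset.range n, qn h (i + 1)

theorem qFact_succ (h n : ℕ) : qFact h (n + 1) = qFact h n * qn h (n + 1) :=
  Finset.prod_range_succ _ _

theorem qFact_ne_zero {h : ℕ} (hh : 2 ≤ h) {n : ℕ} (hn : n < h) : qFact h n ≠ 0 :=
  Finset.prod_ne_zero_iff.2 fun i hi =>
    qn_ne_zero_of_lt hh (by have := Finset.mem_range.1 hi; omega)

/-- The coefficient `q^{m m'} / ([m]! [m']!)` of `|m, m'⟩ ⊗ |m, m'⟩` in an invariant vector. -/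
def invCoeff (h m m' : ℕ) : ℂ := q h ^ ((m : ℤ) * m') / (qFact h m * qFact h m')

theorem invCoeff_ne_zero {h : ℕ} (hh : 2 ≤ h) {m m' : ℕ} (hm : m < h) (hm' : m' < h) :
    invCoeff h m m' ≠ 0 :=
  div_ne_zero (zpow_ne_zero _ (q_ne h)) (mul_ne_zero (qFact_ne_zero hh hm) (qFact_ne_zero hh hm'))

theorem invCoeff_comm (h m m' : ℕ) : invCoeff h m m' = invCoeff h m' m := by
  rw [invCoeff, invCoeff, mul_comm (m : ℤ), mul_comm (qFact h m)]

theorem invCoeff_right_mul {h m m' : ℕ} (hq : qn h (m' + 1) ≠ 0) :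
    invCoeff h m (m' + 1) * qn h (m' + 1) = q h ^ (m : ℤ) * invCoeff h m m' := by
  rw [invCoeff, invCoeff, qFact_succ]
  push_cast
  rw [mul_add, zpow_add₀ (q_ne h), mul_one, ← mul_assoc (qFact h m), div_mul_eq_div_div,
    div_mul_cancel₀ _ hq]
  ring

theorem invCoeff_left_mul {h m m' : ℕ} (hq : qn h (m + 1) ≠ 0) :
    invCoeff h (m + 1) m' * qn h (m + 1) = q h ^ (m' : ℤ) * invCoeff h m m' := by
  rw [invCoeff_comm, invCoeff_right_mul hq, invCoeff_comm]

/-- The vector `∑ q^{m m'} / ([m]! [m']!) |m, m'⟩ ⊗ |m, m'⟩` over `m + m' = N`, where the terms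
with `m` or `m'` at least `h` vanish. -/
def invVec (h N : ℕ) : StateSpace h :=
  ∑ x ∈ Finset.HasAntidiagonal.antidiagonal N, invCoeff h x.1 x.2 • (ket h x.1 x.2 ⊗ₜ[ℂ] ket h x.1 x.2)

theorem map_invVec_zero {h : ℕ} {X : Module.End ℂ (StateSpace h)} {P R : ℕ → ℕ → StateSpace h}
    (hX : ∀ m m', X (ket h m m' ⊗ₜ[ℂ] ket h m m') = P m m' + R m m') (hP : ∀ m, P m 0 = 0)
    (hR : ∀ m', R 0 m' = 0) : X (invVec h 0) = 0 := by
  simp [invVec, hX, hP, hR]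

/-- If `X` maps `|m, m'⟩ ⊗ |m, m'⟩` to `P m m' + R m m'`, where `P` lowers `m'` and `R` lowers
`m`, then the terms of `X (invVec h (N + 1))` can be collected over `m + m' = N`. -/
theorem map_invVec_succ {h : ℕ} {X : Module.End ℂ (StateSpace h)} {P R : ℕ → ℕ → StateSpace h}
    (hX : ∀ m m', X (ket h m m' ⊗ₜ[ℂ] ket h m m') = P m m' + R m m') (hP : ∀ m, P m 0 = 0)
    (hR : ∀ m', R 0 m' = 0) (N : ℕ) :
    X (invVec h (N + 1)) = ∑ x ∈ Finset.HasAntidiagonal.antidiagonal N,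
      (invCoeff h x.1 (x.2 + 1) • P x.1 (x.2 + 1) +
        invCoeff h (x.1 + 1) x.2 • R (x.1 + 1) x.2) := by
  simp only [invVec, map_sum, map_smul, hX, smul_add, Finset.sum_add_distrib]
  rw [Finset.Nat.sum_antidiagonal_succ', Finset.Nat.sum_antidiagonal_succ]
  simp [hP, hR]

/-- A sufficient condition for `X` to kill every `invVec h N`: after the shifts of `map_invVec_succ`
both terms are multiples of the same tensor `T m m'`, and `hpr` makes their coefficients cancel.
By `hT` this is needed only for `m + 1 < h` and `m' + 1 < h`, where `[m + 1]` and `[m' + 1]` do not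
vanish. -/
theorem map_invVec_eq_zero {h : ℕ} {X : Module.End ℂ (StateSpace h)} {p r : ℕ → ℕ → ℂ}
    {P R T : ℕ → ℕ → StateSpace h} (hh : 2 ≤ h)
    (hX : ∀ m m', X (ket h m m' ⊗ₜ[ℂ] ket h m m') =
      (p m m' * qn h m') • P m m' + (r m m' * qn h m) • R m m')
    (hP : ∀ m m', P m (m' + 1) = T m m') (hR : ∀ m m', R (m + 1) m' = T m m')
    (hT : ∀ m m', ¬ (m + 1 < h ∧ m' + 1 < h) → T m m' = 0)
    (hpr : ∀ m m' : ℕ, p m (m' + 1) * q h ^ (m : ℤ) + r (m + 1) m' * q h ^ (m' : ℤ) = 0) (N : ℕ) :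
    X (invVec h N) = 0 := by
  have hP0 : ∀ m, (p m 0 * qn h (0 : ℕ)) • P m 0 = 0 := fun m => by simp [qn_zero]
  have hR0 : ∀ m', (r 0 m' * qn h (0 : ℕ)) • R 0 m' = 0 := fun m => by simp [qn_zero]
  rcases N with _ | N
  · exact map_invVec_zero hX hP0 hR0
  rw [map_invVec_succ hX hP0 hR0]
  refine Finset.sum_eq_zero fun x _ => ?_
  obtain ⟨m, m'⟩ := x
  simp only [hP, hR]
  by_cases hm : m + 1 < h ∧ m' + 1 < h
  · have h1 := invCoeff_right_mul (m := m) (qn_ne_zero_of_lt hh hm.2)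
    have h2 := invCoeff_left_mul (m' := m') (qn_ne_zero_of_lt hh hm.1)
    rw [smul_smul, smul_smul, ← add_smul]
    push_cast
    convert zero_smul ℂ (T m m')
    linear_combination p m (m' + 1) * h1 + r (m + 1) m' * h2 + invCoeff h m m' * hpr m m'
  · rw [hT m m' hm]; simp

theorem genAct_invVec {h : ℕ} (hh : 2 ≤ h) (x : Gen) (N : ℕ) :
    genAct h x (invVec h N) = genCounit x • invVec h N := by
  have hq := q_ne h
  have hq' := qh_ne h
  have hq2 : q h = qh h ^ 2 := by rw [q_eq]; rfl
  have ket_tmul : ∀ m m' n n' : ℕ, ¬ ((m < h ∧ m' < h) ∧ (n < h ∧ n' < h)) →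
      ket h m m' ⊗ₜ[ℂ] ket h n n' = 0 := by
    intro m m' n n' hm
    rcases not_and_or.1 hm with h1 | h1 <;> rw [ket_out h1] <;> simp
  cases x
  case K | Kinv =>
    simp only [genAct, genCounit, one_smul, invVec, map_sum, map_smul, TensorProduct.map_tmul,
      qHhalf_ket, qHbarHalf_ket, TensorProduct.smul_tmul_smul, ← zpow_add₀ hq']
    refine Finset.sum_congr rfl fun x _ => ?_
    ring_nf
    simp
  case L | Linv =>
    simp only [genAct, genCounit, one_smul, invVec, map_sum, map_smul, TensorProduct.map_tmul,
      qP_ket, qPbar, TensorProduct.smul_tmul_smul, ← zpow_add₀ hq]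
    refine Finset.sum_congr rfl fun x _ => ?_
    ring_nf
    simp
  case E =>
    rw [genCounit, zero_smul]
    refine map_invVec_eq_zero hh (p := fun _ _ => 1)
      (r := fun m m' => -(q h ^ ((m : ℤ) - m') * (q h)⁻¹))
      (P := fun m m' => ket h (m + 1) (m' - 1) ⊗ₜ ket h m m')
      (R := fun m m' => ket h m m' ⊗ₜ ket h (m - 1) (m' + 1))
      (T := fun m m' => ket h (m + 1) m' ⊗ₜ ket h m (m' + 1)) ?_ (fun _ _ => rfl)
      (fun _ _ => rfl) (fun m m' hm => ket_tmul _ _ _ _ (by omega)) ?_ N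
    · intro m m'
      simp only [genAct, LinearMap.add_apply, TensorProduct.map_tmul, opE_ket hh, opEbar_ket hh,
        qHhalf_ket, qh_zpow_two, Module.End.one_apply, TensorProduct.tmul_smul,
        ← TensorProduct.smul_tmul', smul_smul, one_mul]
      congr 2
      ring
    · intro m m'
      push_cast
      rw [zpow_sub₀ hq, zpow_add₀ hq]
      field_simp
      ring
  case F =>
    rw [genCounit, zero_smul]
    refine map_invVec_eq_zero hh (p := fun _ _ => -q h)
      (r := fun m m' => q h ^ ((m : ℤ) - m'))
      (P := fun m m' => ket h m m' ⊗ₜ ket h (m + 1) (m' - 1))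
      (R := fun m m' => ket h (m - 1) (m' + 1) ⊗ₜ ket h m m')
      (T := fun m m' => ket h m (m' + 1) ⊗ₜ ket h (m + 1) m') ?_ (fun _ _ => rfl)
      (fun _ _ => rfl) (fun m m' hm => ket_tmul _ _ _ _ (by omega)) ?_ N
    · intro m m'
      have hz : qh h ^ (-2 * ((m' : ℤ) - m)) = q h ^ ((m : ℤ) - m') := by
        rw [← qh_zpow_two]; congr 1; ring
      simp only [genAct, LinearMap.add_apply, TensorProduct.map_tmul, opF_ket hh, opFbar_ket hh,
        qHbarHalf_ket, hz, Module.End.one_apply, TensorProduct.tmul_smul,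
        ← TensorProduct.smul_tmul', smul_smul]
      rw [add_comm]
      congr 2
      ring
    · intro m m'
      push_cast
      rw [zpow_sub₀ hq, zpow_add₀ hq]
      field_simp
      ring
  case B =>
    rw [genCounit, zero_smul]
    refine map_invVec_eq_zero hh (p := fun _ _ => qh h)
      (r := fun m m' => -(q h ^ (m : ℤ) * (qh h)⁻¹ * q h ^ (-(m' : ℤ))))
      (P := fun m m' => ket h (m + 1) m' ⊗ₜ ket h m (m' - 1))
      (R := fun m m' => ket h m (m' + 1) ⊗ₜ ket h (m - 1) m')
      (T := fun m m' => ket h (m + 1) (m' + 1) ⊗ₜ ket h m m') ?_ (fun _ _ => rfl)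
      (fun _ _ => rfl) (fun m m' hm => ket_tmul _ _ _ _ (by omega)) ?_ N
    · intro m m'
      simp only [genAct, contr, Fin.sum_univ_two, abar, LinearMap.add_apply,
        TensorProduct.map_tmul, a00_ket, a01_ket, a10_ket hh, a11_ket hh,
        TensorProduct.tmul_smul, ← TensorProduct.smul_tmul', smul_smul]
      congr 2
      ring
    · intro m m'
      push_cast
      rw [zpow_neg, zpow_add₀ hq, zpow_one, hq2]
      field_simp
      ring
  case B' =>
    rw [genCounit, zero_smul]
    refine map_invVec_eq_zero hh (p := fun _ _ => -qh h)
      (r := fun m m' => q h ^ (m : ℤ) * (qh h)⁻¹ * q h ^ (-(m' : ℤ)))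
      (P := fun m m' => ket h m (m' - 1) ⊗ₜ ket h (m + 1) m')
      (R := fun m m' => ket h (m - 1) m' ⊗ₜ ket h m (m' + 1))
      (T := fun m m' => ket h m m' ⊗ₜ ket h (m + 1) (m' + 1)) ?_ (fun _ _ => rfl)
      (fun _ _ => rfl) (fun m m' hm => ket_tmul _ _ _ _ (by omega)) ?_ N
    · intro m m'
      simp only [genAct, contr, Fin.sum_univ_two, abar, LinearMap.add_apply, LinearMap.neg_apply,
        TensorProduct.map_tmul, a00_ket, a01_ket, a10_ket hh, a11_ket hh,
        TensorProduct.tmul_smul, ← TensorProduct.smul_tmul', smul_smul]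
      module
    · intro m m'
      push_cast
      rw [zpow_neg, zpow_add₀ hq, zpow_one, hq2]
      field_simp
      ring

/-- It suffices to test invariance on the generators. -/
theorem mem_invariants_iff {h : ℕ} {v : StateSpace h} :
    v ∈ invariants h ↔ ∀ x, genAct h x v = genCounit x • v := by
  constructor
  · intro hv x
    simpa [act, counit] using hv (FreeAlgebra.ι ℂ x)
  · intro hv X
    induction X using FreeAlgebra.induction with
    | grade0 r => simp [Algebra.algebraMap_eq_smul_one]
    | grade1 x => simpa [act, counit] using hv x
    | mul x y hx hy =>
      rw [map_mul, map_mul, Module.End.mul_apply, hy, map_smul, hx, smul_smul, mul_comm]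
    | add x y hx hy => rw [map_add, map_add, LinearMap.add_apply, hx, hy, add_smul]

theorem invVec_mem (h : ℕ) (hh : 2 ≤ h) (N : ℕ) : invVec h N ∈ invariants h :=
  mem_invariants_iff.2 fun x => genAct_invVec hh x N

/-- The square of `[m' + 1]` makes this form hold at `m' + 1 = h` too, where both sides vanish. -/
theorem invCoeff_right_mul_sq (h m m' : ℕ) :
    invCoeff h m (m' + 1) * qn h (m' + 1) ^ 2 =
      q h ^ (m : ℤ) * qn h (m' + 1) * invCoeff h m m' := by
  by_cases hq : qn h (m' + 1) = 0
  · simp [hq]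
  · linear_combination qn h (m' + 1) * invCoeff_right_mul (m := m) hq

theorem A_tmul_ket {h : ℕ} (hh : 2 ≤ h) (m m' : ℕ) :
    A h (ket h m m' ⊗ₜ[ℂ] ket h m m') =
      (q h * qn h m' ^ 2) • (ket h m (m' - 1) ⊗ₜ[ℂ] ket h m (m' - 1)) +
      ((q h)⁻¹ * q h ^ (-2 * (m' : ℤ)) * qn h m ^ 2) •
        (ket h (m - 1) m' ⊗ₜ[ℂ] ket h (m - 1) m') := by
  have hq2 : q h = qh h ^ 2 := by rw [q_eq]; rfl
  have hz : q h ^ (-2 * (m' : ℤ)) = (q h ^ (-(m' : ℤ))) ^ 2 := by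
    rw [← zpow_natCast, ← zpow_mul]; congr 1; push_cast; ring
  simp only [A, contr, Fin.sum_univ_two, abar, LinearMap.add_apply, TensorProduct.map_tmul,
    a10_ket hh, a11_ket hh, TensorProduct.smul_tmul_smul]
  congr 2
  · rw [hq2]; ring
  · rw [hz, show (q h)⁻¹ = (qh h)⁻¹ ^ 2 by rw [hq2, inv_pow]]; ring

theorem A_invVec_zero {h : ℕ} (hh : 2 ≤ h) : A h (invVec h 0) = 0 :=
  map_invVec_zero (A_tmul_ket hh) (fun m => by simp [qn_zero]) (fun m' => by simp [qn_zero])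

/-- On the invariant vectors `A` is a weighted shift whose weights vanish only where `h` divides
`N + 2`. -/
theorem A_invVec_succ {h : ℕ} (hh : 2 ≤ h) (N : ℕ) :
    A h (invVec h (N + 1)) = qn h (N + 2) • invVec h N := by
  have hq := q_ne h
  rw [map_invVec_succ (A_tmul_ket hh) (fun m => by simp [qn_zero]) (fun m' => by simp [qn_zero]),
    invVec, Finset.smul_sum]
  refine Finset.sum_congr rfl fun x hx => ?_
  obtain ⟨m, m'⟩ := x
  obtain rfl : m + m' = N := Finset.HasAntidiagonal.mem_antidiagonal.1 hx
  simp only [Nat.add_sub_cancel, smul_smul, ← add_smul]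
  congr 1
  have h1 := invCoeff_right_mul_sq h m m'
  have h2 := invCoeff_right_mul_sq h m' m
  rw [invCoeff_comm, invCoeff_comm h m' m] at h2
  have h3 : qn h (((m + m' : ℕ) : ℤ) + 2) =
      q h * q h ^ (m : ℤ) * qn h (m' + 1) + (q h)⁻¹ * q h ^ (-(m' : ℤ)) * qn h (m + 1) := by
    rw [show ((m + m' : ℕ) : ℤ) + 2 = (m' + 1) + (m + 1) by push_cast; ring, qn_add, neg_add,
      zpow_add₀ hq, zpow_add₀ hq, zpow_one, zpow_neg_one]
    ring
  have h4 : q h ^ (-2 * (m' : ℤ)) * q h ^ (m' : ℤ) = q h ^ (-(m' : ℤ)) := by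
    rw [← zpow_add₀ hq]; congr 1; ring
  push_cast at h3 ⊢
  rw [h3]
  linear_combination q h * h1 + (q h)⁻¹ * q h ^ (-2 * (m' : ℤ)) * h2 +
    (q h)⁻¹ * qn h (m + 1) * invCoeff h m m' * h4

/-! ### Coordinates on the state space -/

/-- The coordinate of a Fock space vector at `ket h m m'`, zero if `m` or `m'` is at least `h`. -/
def ketCoord (h m m' : ℕ) : Fock h →ₗ[ℂ] ℂ :=
  if hm : m < h ∧ m' < h then LinearMap.proj (⟨m, hm.1⟩, ⟨m', hm.2⟩) else 0

theorem ketCoord_ket (h m m' n n' : ℕ) : ketCoord h m m' (ket h n n') =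
    if (m < h ∧ m' < h) ∧ n = m ∧ n' = m' then 1 else 0 := by
  unfold ketCoord ket
  split_ifs <;> simp_all [Prod.ext_iff, eq_comm]

theorem ext_ket {h : ℕ} {f g : Fock h →ₗ[ℂ] ℂ}
    (hfg : ∀ m m', m < h → m' < h → f (ket h m m') = g (ket h m m')) : f = g := by
  refine (Pi.basisFun ℂ (Fin h × Fin h)).ext fun x => ?_
  have := hfg x.1 x.2 x.1.2 x.2.2
  rw [ket, dif_pos ⟨x.1.2, x.2.2⟩] at this
  rw [Pi.basisFun_apply]
  exact this

theorem ketCoord_qHhalf (h : ℕ) (e : ℤ) (m m' : ℕ) :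
    ketCoord h m m' ∘ₗ qHhalf h e = qh h ^ (e * (m - m')) • ketCoord h m m' := by
  refine ext_ket fun n n' _ _ => ?_
  simp only [LinearMap.comp_apply, LinearMap.smul_apply, qHhalf_ket, map_smul, ketCoord_ket]
  split_ifs with hc
  · rw [hc.2.1, hc.2.2]
  · simp

theorem ketCoord_qHbarHalf (h : ℕ) (e : ℤ) (m m' : ℕ) :
    ketCoord h m m' ∘ₗ qHbarHalf h e = qh h ^ (e * (m' - m)) • ketCoord h m m' := by
  refine ext_ket fun n n' _ _ => ?_
  simp only [LinearMap.comp_apply, LinearMap.smul_apply, qHbarHalf_ket, map_smul, ketCoord_ket]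
  split_ifs with hc
  · rw [hc.2.1, hc.2.2]
  · simp

theorem ketCoord_qP (h : ℕ) (e : ℤ) (m m' : ℕ) :
    ketCoord h m m' ∘ₗ qP h e = q h ^ (e * (m + m' + 1)) • ketCoord h m m' := by
  refine ext_ket fun n n' _ _ => ?_
  simp only [LinearMap.comp_apply, LinearMap.smul_apply, qP_ket, map_smul, ketCoord_ket]
  split_ifs with hc
  · rw [hc.2.1, hc.2.2]
  · simp

theorem ketCoord_opE {h : ℕ} (hh : 2 ≤ h) {m m' : ℕ} (hm : m + 1 < h) (hm' : m' + 1 < h) :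
    ketCoord h (m + 1) m' ∘ₗ opE h = qn h (m' + 1) • ketCoord h m (m' + 1) := by
  refine ext_ket fun n n' _ _ => ?_
  simp only [LinearMap.comp_apply, LinearMap.smul_apply, opE_ket hh, map_smul, ketCoord_ket]
  rcases n' with _ | n'
  · simp [qn_zero]
  · split_ifs with h1 h2 h2
    · rw [h2.2.2]; push_cast; rfl
    · omega
    · omega
    · simp

theorem ketCoord_opEbar {h : ℕ} (hh : 2 ≤ h) {m m' : ℕ} (hm : m + 1 < h) (hm' : m' + 1 < h) :
    ketCoord h m (m' + 1) ∘ₗ opEbar h =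
      (-((q h)⁻¹ * qn h (m + 1))) • ketCoord h (m + 1) m' := by
  refine ext_ket fun n n' _ _ => ?_
  simp only [LinearMap.comp_apply, LinearMap.smul_apply, opEbar_ket hh, map_smul, ketCoord_ket]
  rcases n with _ | n
  · simp [qn_zero]
  · split_ifs with h1 h2 h2
    · rw [h2.2.1]; push_cast; rfl
    · omega
    · omega
    · simp

/-- The product of two linear forms, as a linear form on the state space. -/
def tensorForm {h : ℕ} (f g : Fock h →ₗ[ℂ] ℂ) : StateSpace h →ₗ[ℂ] ℂ :=
  LinearMap.mul' ℂ ℂ ∘ₗ TensorProduct.map f g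

theorem tensorForm_tmul {h : ℕ} (f g : Fock h →ₗ[ℂ] ℂ) (u w : Fock h) :
    tensorForm f g (u ⊗ₜ w) = f u * g w := by
  simp [tensorForm]

theorem tensorForm_map {h : ℕ} (f g : Fock h →ₗ[ℂ] ℂ) (X Y : Module.End ℂ (Fock h))
    (v : StateSpace h) :
    tensorForm f g (TensorProduct.map X Y v) = tensorForm (f ∘ₗ X) (g ∘ₗ Y) v := by
  simp [tensorForm, TensorProduct.map_comp]

theorem tensorForm_smul_left {h : ℕ} (c : ℂ) (f g : Fock h →ₗ[ℂ] ℂ) (v : StateSpace h) :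
    tensorForm (c • f) g v = c * tensorForm f g v := by
  simp [tensorForm, TensorProduct.map_smul_left]

theorem tensorForm_smul_right {h : ℕ} (c : ℂ) (f g : Fock h →ₗ[ℂ] ℂ) (v : StateSpace h) :
    tensorForm f (c • g) v = c * tensorForm f g v := by
  simp [tensorForm, TensorProduct.map_smul_right]

/-- The coordinate of a state at `ket h m m' ⊗ ket h n n'`. -/
def coord (h m m' n n' : ℕ) : StateSpace h →ₗ[ℂ] ℂ :=
  tensorForm (ketCoord h m m') (ketCoord h n n')

/-- The `coord h m m' n n'` are the coordinates with respect to the tensor product basis. -/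
theorem ext_coord {h : ℕ} {v w : StateSpace h}
    (hvw : ∀ m m' n n', m < h → m' < h → n < h → n' < h →
      coord h m m' n n' v = coord h m m' n n' w) : v = w := by
  have hb : ∀ x : (Fin h × Fin h) × (Fin h × Fin h),
      ((Pi.basisFun ℂ (Fin h × Fin h)).tensorProduct (Pi.basisFun ℂ (Fin h × Fin h))).coord x =
        coord h x.1.1 x.1.2 x.2.1 x.2.2 := by
    intro x
    refine TensorProduct.ext' fun u w => ?_
    have h1 := Module.Basis.tensorProduct_repr_tmul_apply (Pi.basisFun ℂ (Fin h × Fin h))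
      (Pi.basisFun ℂ (Fin h × Fin h)) u w x.1 x.2
    rw [Module.Basis.coord_apply, coord, tensorForm_tmul]
    refine h1.trans ?_
    simp [ketCoord, mul_comm]
  refine (((Pi.basisFun ℂ (Fin h × Fin h)).tensorProduct
    (Pi.basisFun ℂ (Fin h × Fin h))).ext_elem fun x => ?_)
  rw [← Module.Basis.coord_apply, ← Module.Basis.coord_apply, hb]
  exact hvw _ _ _ _ x.1.1.2 x.1.2.2 x.2.1.2 x.2.2.2

theorem coord_invVec {h m m' n n' : ℕ} (hm : m < h) (hm' : m' < h) (hn : n < h) (hn' : n' < h)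
    (N : ℕ) : coord h m m' n n' (invVec h N) =
      if n = m ∧ n' = m' ∧ N = m + m' then invCoeff h m m' else 0 := by
  have key : ∀ x : ℕ × ℕ, coord h m m' n n'
      (invCoeff h x.1 x.2 • (ket h x.1 x.2 ⊗ₜ[ℂ] ket h x.1 x.2)) =
        if x = (m, m') ∧ n = m ∧ n' = m' then invCoeff h m m' else 0 := by
    rintro ⟨k, k'⟩
    rw [map_smul, coord, tensorForm_tmul, ketCoord_ket, ketCoord_ket]
    simp only [hm, hm', hn, hn', Prod.mk.injEq, true_and]
    by_cases h1 : k = m ∧ k' = m'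
    · obtain ⟨rfl, rfl⟩ := h1
      simp [eq_comm]
    · simp [h1]
  rw [invVec, map_sum, Finset.sum_congr rfl fun x _ => key x]
  by_cases h1 : n = m ∧ n' = m'
  · simp [h1, Finset.sum_ite_eq', Finset.HasAntidiagonal.mem_antidiagonal, eq_comm]
  · simp only [h1, and_false, if_false, Finset.sum_const_zero]
    rw [if_neg (by tauto)]

/-! ### The invariant vectors -/

/-- Invariance under `q^{p - p̄}` and `q^{(H + H̄)/2}`, whose eigenvalues separate the values of
`p - p̄` and `H + H̄` that occur, confines an invariant vector to the diagonal. -/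
theorem coord_eq_zero_of_invariant {h : ℕ} (hh : 2 ≤ h) {v : StateSpace h}
    (hv : v ∈ invariants h) {m m' n n' : ℕ} (hm : m < h) (hm' : m' < h) (hn : n < h)
    (hn' : n' < h) (hne : ¬ (n = m ∧ n' = m')) : coord h m m' n n' v = 0 := by
  have hq := q_ne h
  have hq' := qh_ne h
  rw [mem_invariants_iff] at hv
  by_contra hc
  have hprim : IsPrimitiveRoot (qh h) (4 * h) := by
    have : qh h = Complex.exp (2 * Real.pi * Complex.I / (4 * h : ℕ)) := by
      rw [qh]; congr 1; push_cast
      have : (h : ℂ) ≠ 0 := by exact_mod_cast (by omega : h ≠ 0)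
      field_simp
      ring
    rw [this]
    exact Complex.isPrimitiveRoot_exp _ (by omega)
  have hK : coord h m m' n n' (genAct h .K v) = coord h m m' n n' (genCounit .K • v) := by
    rw [hv]
  rw [coord, genAct, tensorForm_map, ketCoord_qHhalf, ketCoord_qHbarHalf, tensorForm_smul_left,
    tensorForm_smul_right, ← mul_assoc, ← zpow_add₀ hq', genCounit, one_smul] at hK
  have hK := mul_right_cancel₀ hc (hK.trans (one_mul _).symm)
  have hL : coord h m m' n n' (genAct h .L v) = coord h m m' n n' (genCounit .L • v) := by
    rw [hv]
  rw [coord, genAct, tensorForm_map, qPbar, ketCoord_qP, ketCoord_qP, tensorForm_smul_left,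
    tensorForm_smul_right, ← mul_assoc, ← zpow_add₀ hq, genCounit, one_smul] at hL
  have hL := mul_right_cancel₀ hc (hL.trans (one_mul _).symm)
  rw [q_eq, ← zpow_mul, hprim.zpow_eq_one_iff_dvd] at hL
  rw [hprim.zpow_eq_one_iff_dvd] at hK
  have hK0 := Int.eq_zero_of_abs_lt_dvd hK (by rw [abs_lt]; push_cast; constructor <;> omega)
  have hL0 := Int.eq_zero_of_abs_lt_dvd hL (by rw [abs_lt]; push_cast; constructor <;> omega)
  omega

/-- Invariance under `E + q^H Ē` relates neighbouring diagonal coordinates with the same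
`m + m'` in the same way as the coefficients `invCoeff`. -/
theorem coord_div_invCoeff_step {h : ℕ} (hh : 2 ≤ h) {v : StateSpace h}
    (hv : v ∈ invariants h) {m m' : ℕ} (hm : m + 1 < h) (hm' : m' + 1 < h) :
    coord h (m + 1) m' (m + 1) m' v / invCoeff h (m + 1) m' =
      coord h m (m' + 1) m (m' + 1) v / invCoeff h m (m' + 1) := by
  have hq := q_ne h
  rw [mem_invariants_iff] at hv
  have hE : coord h (m + 1) m' m (m' + 1) (genAct h .E v) =
      coord h (m + 1) m' m (m' + 1) (genCounit .E • v) := by rw [hv]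
  rw [genCounit, zero_smul, map_zero, coord, genAct, LinearMap.add_apply, map_add, tensorForm_map,
    tensorForm_map, ketCoord_opE hh hm hm', ketCoord_opEbar hh hm hm', ketCoord_qHhalf,
    tensorForm_smul_left, tensorForm_smul_left, tensorForm_smul_right, qh_zpow_two,
    Module.End.one_eq_id, LinearMap.comp_id] at hE
  have hn := qn_ne_zero_of_lt hh hm
  have hn' := qn_ne_zero_of_lt hh hm'
  have h3 := invCoeff_ne_zero hh (m := m) (m' := m') (by omega) (by omega)
  rw [eq_div_of_mul_eq hn' (invCoeff_right_mul (m := m) hn'),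
    eq_div_of_mul_eq hn (invCoeff_left_mul (m' := m') hn), coord, coord]
  push_cast at hE
  rw [zpow_sub₀ hq, zpow_add₀ hq, zpow_one] at hE
  field_simp at hE ⊢
  linear_combination -hE

/-- The ratios of the diagonal coordinates to `invCoeff` depend on `m + m'` only, so an invariant
vector is a combination of the `invVec h N`. -/
theorem invariant_eq_sum {h : ℕ} (hh : 2 ≤ h) {v : StateSpace h} (hv : v ∈ invariants h) :
    ∃ s : ℕ → ℂ, v = ∑ N ∈ Finset.range (2 * h - 1), s N • invVec h N := by
  -- the common value of the ratios is read off where `m` is smallest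
  let s : ℕ → ℂ := fun N =>
    coord h (N - min N (h - 1)) (min N (h - 1)) (N - min N (h - 1)) (min N (h - 1)) v /
      invCoeff h (N - min N (h - 1)) (min N (h - 1))
  have hs : ∀ m m', m < h → m' < h → coord h m m' m m' v / invCoeff h m m' = s (m + m') := by
    intro m
    induction m with
    | zero =>
      intro m' _ hm'
      simp only [s]
      rw [zero_add, min_eq_left (by omega), Nat.sub_self]
    | succ m ih =>
      intro m' hm hm'
      by_cases h1 : m' + 1 < h
      · rw [coord_div_invCoeff_step hh hv hm h1, ih _ (by omega) h1]
        congr 1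
        omega
      · simp only [s]
        rw [min_eq_right (by omega), show m + 1 + m' - (h - 1) = m + 1 by omega,
          show h - 1 = m' by omega]
  refine ⟨s, ext_coord fun m m' n n' hm hm' hn hn' => ?_⟩
  rw [map_sum]
  simp only [map_smul, coord_invVec hm hm' hn hn']
  by_cases h1 : n = m ∧ n' = m'
  · obtain ⟨rfl, rfl⟩ := h1
    simp only [true_and, smul_eq_mul, mul_ite, mul_zero]
    rw [Finset.sum_ite_eq', if_pos (Finset.mem_range.2 (by omega)), ← hs _ _ hm hm',
      div_mul_cancel₀ _ (invCoeff_ne_zero hh hm hm')]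
  · rw [coord_eq_zero_of_invariant hh hv hm hm' hn hn' h1]
    refine (Finset.sum_eq_zero fun N _ => ?_).symm
    rw [if_neg (by tauto), smul_zero]

theorem linearIndependent_invVec {h : ℕ} (hh : 2 ≤ h) :
    LinearIndependent ℂ fun N : Fin (2 * h - 1) => invVec h N := by
  rw [Fintype.linearIndependent_iff]
  intro c hc N
  have hm : (N : ℕ) - min (N : ℕ) (h - 1) < h := by omega
  have hm' : min (N : ℕ) (h - 1) < h := by omega
  -- the coordinate at the smallest `m` with `m + m' = N` singles out the term of `N`
  have h1 := congrArg (coord h (N - min (N : ℕ) (h - 1)) (min (N : ℕ) (h - 1))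
    (N - min (N : ℕ) (h - 1)) (min (N : ℕ) (h - 1))) hc
  rw [map_sum, map_zero] at h1
  simp only [map_smul, coord_invVec hm hm' hm hm', true_and] at h1
  rw [Finset.sum_eq_single N] at h1
  · rw [if_pos (by omega), smul_eq_mul] at h1
    exact (mul_eq_zero.1 h1).resolve_right (invCoeff_ne_zero hh hm hm')
  · intro M _ hM
    rw [if_neg (fun h2 => hM (Fin.ext (by omega))), smul_zero]
  · simp

/-- The vectors `invVec h N`, `0 ≤ N ≤ 2 h - 2`, as a basis of the space of invariants. -/
def invBasis (h : ℕ) (hh : 2 ≤ h) : Module.Basis (Fin (2 * h - 1)) ℂ (invariants h) :=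
  Module.Basis.mk (v := fun N => (⟨invVec h N, invVec_mem h hh N⟩ : invariants h))
    (LinearIndependent.of_comp (invariants h).subtype (linearIndependent_invVec hh)) (by
      rintro ⟨v, hv⟩ -
      obtain ⟨s, hs⟩ := invariant_eq_sum hh hv
      have : (⟨v, hv⟩ : invariants h) =
          ∑ N : Fin (2 * h - 1), s N • (⟨invVec h N, invVec_mem h hh N⟩ : invariants h) := by
        ext1
        rw [Submodule.coe_sum]
        exact hs.trans (Finset.sum_range _)
      rw [this]
      exact Submodule.sum_mem _ fun N _ =>
        Submodule.smul_mem _ _ (Submodule.subset_span (Set.mem_range_self N)))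

theorem coe_invBasis {h : ℕ} (hh : 2 ≤ h) (N : Fin (2 * h - 1)) :
    (invBasis h hh N : StateSpace h) = invVec h N := by
  simp [invBasis]

theorem finrank_invariants {h : ℕ} (hh : 2 ≤ h) :
    Module.finrank ℂ (invariants h) = 2 * h - 1 := by
  rw [Module.finrank_eq_card_basis (invBasis h hh), Fintype.card_fin]

/-! ### The differential on the invariant vectors -/

/-- A chain `invVec h (N + j) ↦ ⋯ ↦ invVec h N` that ends in `ker A` is killed by `A^(j+1)`. -/
theorem A_pow_invVec {h : ℕ} (hh : 2 ≤ h) {N : ℕ} (hN : A h (invVec h N) = 0) (j : ℕ) :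
    (A h ^ (j + 1)) (invVec h (N + j)) = 0 := by
  induction j with
  | zero => simpa using hN
  | succ j ih =>
    rw [pow_succ, Module.End.mul_apply, ← add_assoc, A_invVec_succ hh, map_smul, ih, smul_zero]

theorem AI_pow {h : ℕ} (hh : 2 ≤ h) : AI h hh ^ h = 0 := by
  refine (invBasis h hh).ext fun N => Subtype.ext ?_
  rw [AI, Module.End.pow_restrict, LinearMap.coe_restrict_apply, coe_invBasis]
  change _ = (0 : StateSpace h)
  have hmid : A h (invVec h (h - 1)) = 0 := by
    obtain ⟨k, rfl⟩ : ∃ k, h = k + 2 := ⟨h - 2, by omega⟩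
    rw [show k + 2 - 1 = k + 1 by omega, A_invVec_succ hh]
    have := qn_h hh
    push_cast at this
    rw [this, zero_smul]
  -- the chain of `N` ends at `0` or at `h - 1`, after at most `h` steps
  obtain ⟨M, j, hMj, hj, hM⟩ : ∃ M j, (N : ℕ) = M + j ∧ j < h ∧ A h (invVec h M) = 0 := by
    by_cases hN : (N : ℕ) < h
    · exact ⟨0, N, by omega, hN, A_invVec_zero hh⟩
    · exact ⟨h - 1, N - (h - 1), by omega, by omega, hmid⟩
  have hpow : A h ^ h = A h ^ (h - (j + 1)) * A h ^ (j + 1) := by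
    rw [← pow_add, Nat.sub_add_cancel hj]
  rw [hMj, hpow, Module.End.mul_apply, A_pow_invVec hh hM, map_zero]

/-- Every `invVec h N` with `N ≤ 2 h - 3` and `N ≠ h - 2` lies in the range of `A`. -/
theorem le_finrank_range_AI {h : ℕ} (hh : 2 ≤ h) :
    2 * h - 3 ≤ Module.finrank ℂ (LinearMap.range (AI h hh)) := by
  let s : Finset (Fin (2 * h - 1)) :=
    (Finset.univ.erase ⟨h - 2, by omega⟩).erase ⟨2 * h - 2, by omega⟩
  have hcard : s.card = 2 * h - 3 := by
    rw [Finset.card_erase_of_mem, Finset.card_erase_of_mem (Finset.mem_univ _),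
      Finset.card_univ, Fintype.card_fin]
    · omega
    · refine Finset.mem_erase.2 ⟨fun h1 => ?_, Finset.mem_univ _⟩
      have := Fin.mk.inj_iff.1 h1
      omega
  have hli := finrank_span_eq_card
    ((invBasis h hh).linearIndependent.comp (Subtype.val : s → _) Subtype.val_injective)
  rw [Fintype.card_coe, hcard] at hli
  rw [← hli]
  refine Submodule.finrank_mono (Submodule.span_le.2 ?_)
  rintro _ ⟨⟨N, hN⟩, rfl⟩
  have hN2 : (N : ℕ) ≠ 2 * h - 2 := fun h1 => (Finset.mem_erase.1 hN).1 (Fin.ext h1)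
  have hN1 : (N : ℕ) ≠ h - 2 := fun h1 =>
    (Finset.mem_erase.1 (Finset.mem_erase.1 hN).2).1 (Fin.ext h1)
  have hqn : qn h ((N : ℕ) + 2) ≠ 0 := by
    intro h1
    obtain ⟨c, hc⟩ := dvd_of_qn_eq_zero hh h1
    have hc0 : 0 < c := by by_contra hc0; nlinarith
    have hc2 : c < 2 := by
        by_contra hc2
        have := N.2
        have : (h : ℤ) * 2 ≤ h * c := by gcongr; omega
        omega
    obtain rfl : c = 1 := by omega
    omega
  refine ⟨(qn h ((N : ℕ) + 2))⁻¹ • invBasis h hh ⟨N + 1, by omega⟩, Subtype.ext ?_⟩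
  rw [map_smul, Submodule.coe_smul, AI, LinearMap.coe_restrict_apply, coe_invBasis,
    A_invVec_succ hh, smul_smul, inv_mul_cancel₀ hqn, one_smul, Function.comp_apply,
    coe_invBasis]

theorem finrank_genHomology_AI {h : ℕ} (hh : 2 ≤ h) {n : ℕ} (hn : n ∈ Finset.Icc 1 (h - 1)) :
    Module.finrank ℂ (GenHomology h n (E := invariants h) (AI h hh)) = 1 := by
  apply finrank_genHomology_eq_one (E := invariants h) (d := AI h hh) _ _ _ hn
  · exact AI_pow hh
  · exact finrank_invariants hh
  · exact le_finrank_range_AI hh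

theorem finrank_stateSpace (h : ℕ) : Module.finrank ℂ (StateSpace h) = h ^ 4 := by
  rw [Module.finrank_tensorProduct, Module.finrank_fintype_fun_eq_card, Fintype.card_prod,
    Fintype.card_fin]
  ring

end

end ZeroModes

theorem mainTheorem3 (h : ℕ) (hh : 2 ≤ h) :
    -- the state space has dimension `h^4`
    Module.finrank ℂ (StateSpace h) = h ^ 4 ∧
    -- the generalized homologies of `A` on the invariant vectors are one-dimensional
    (∀ n ∈ Finset.Icc 1 (h - 1), Module.finrank ℂ (GenHomology h n (E := invariants h) (AI h hh)) = 1) ∧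
    -- one-dimensional generalized homologies force the dimension to be `±1` modulo `h`
    (∀ (E : Type*) [AddCommGroup E] [Module ℂ E] [FiniteDimensional ℂ E] (d : Module.End ℂ E),
      d ^ h = 0 →
      (∀ n ∈ Finset.Icc 1 (h - 1), Module.finrank ℂ (GenHomology h n d) = 1) →
      (Module.finrank ℂ E : ℤ) ≡ 1 [ZMOD h] ∨ (Module.finrank ℂ E : ℤ) ≡ -1 [ZMOD h]) ∧
    -- there is no `h`-differential on the state space with the same generalized homologies
    ¬ ∃ Q : Module.End ℂ (StateSpace h), Q ^ h = 0 ∧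
      ∀ n ∈ Finset.Icc 1 (h - 1),
        Nonempty (GenHomology h n (E := StateSpace h) Q ≃ₗ[ℂ] GenHomology h n (E := invariants h) (AI h hh)) := by
  refine ⟨finrank_stateSpace h, fun n hn => finrank_genHomology_AI hh hn,
    fun E _ _ _ d hd hE => finrank_modEq_of_finrank_genHomology hh hd hE, ?_⟩
  rintro ⟨Q, hQ, hiso⟩
  have hmod := finrank_modEq_of_finrank_genHomology hh hQ fun n hn => by
    obtain ⟨e⟩ := hiso n hn
    rw [e.finrank_eq, finrank_genHomology_AI hh hn]
  -- `h` divides `h ^ 4`, so it would divide `1`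
  have hdvd : (h : ℤ) ∣ (Module.finrank ℂ (StateSpace h) : ℤ) := by
    rw [finrank_stateSpace]
    exact_mod_cast dvd_pow_self h four_ne_zero
  have hone : (h : ℤ) ∣ 1 := by
    rcases hmod with h1 | h1
    · exact h1.dvd_iff.1 hdvd
    · exact dvd_neg.1 (h1.dvd_iff.1 hdvd)
  have := Int.le_of_dvd one_pos hone
  omega
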